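/- A finite graph is \emph{leveled planar} if it has a planar straight-line drawing in which every vertex lies on one of the parallel lines $y=k$ ($k\in\mathbb Z$) and every edge joins vertices on two consecutive lines. A \emph{$t$-boundaried graph} is a finite graph with $t$ distinct boundary vertices labeled $1,\dots,t$; the gluing $G_1\oplus G_2$ is obtained from the disjoint union of $G_1$ and $G_2$ by identifying boundary vertices with equal labels (merging parallel edges, keeping the labels). The \emph{standard operators} on $t$-boundaried graphs are: the constant consisting of $t$ isolated vertices labeled $1,\dots,t$; the cyclic shift of the labels; the interchange of the labels $1$ and $2$; the addition of an edge between the vertices labeled $1$ and $2$; the addition of a new isolated vertex that receives the label $1$ (the vertex previously labeled $1$ stays in the graph, without label); and the gluing $\oplus$. A \emph{parse tree} is a finite term $T$ over these operators, and it generates a $t$-boundaried graph $G_t(T)$. A family $F$ of graphs is \emph{$t$-finite state} if there is a finite (bottom-up, possibly nondeterministic) tree automaton that accepts exactly those parse trees $T$ for which the underlying graph of $G_t(T)$ belongs to $F$. \textbf{Theorem.} For every $t\ge 6$, the family of leveled planar graphs is not $t$-finite state; that is, no finite tree automaton over parse trees accepts exactly the parse trees $T$ for which $G_t(T)$ is leveled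 planar. Moreover, for every $t\ge 6$, leveled planarity is not expressible in the logic to which Courcelle's theorem applies: there is no sentence $\varphi$ of counting monadic second-order logic with quantification over vertices, edges, and sets of vertices and edges (with the incidence relation and the predicates $|X|\equiv r \pmod q$, $q\geq 1$) such that for every parse tree $T$ the underlying graph of $G_t(T)$ satisfies $\varphi$ if and only if it is leveled planar. In particular, no such sentence defines the leveled planar graphs among all finite graphs. -/

import Mathlib

/-! ### Leveled planar graphs -/

/-- A leveled planar drawing: every vertex `v` is placed on one of the parallel lines
`y = k`, `k ∈ ℤ`, at the point `(pos v, level v)`; every edge joins vertices on consecutive lines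
and is drawn as a straight segment; and the drawing is planar, i.e. distinct vertices are at distinct
points, no vertex lies in the interior of an edge, and the interiors of distinct edges are
disjoint. -/
structure LeveledPlanarDrawing {V : Type*} (G : SimpleGraph V) where
  level : V → ℤ
  pos : V → ℝ
  level_adj : ∀ u v, G.Adj u v → |level u - level v| = 1
  point_injective : Function.Injective (fun v => ((pos v, (level v : ℝ)) : ℝ × ℝ))
  vertex_not_mem_edge : ∀ u v w, G.Adj u v →
    ((pos w, (level w : ℝ)) : ℝ × ℝ) ∉
      openSegment ℝ ((pos u, (level u : ℝ)) : ℝ × ℝ) (pos v, (level v : ℝ))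
  edges_disjoint : ∀ u v u' v', G.Adj u v → G.Adj u' v' → s(u, v) ≠ s(u', v') →
    Disjoint (openSegment ℝ ((pos u, (level u : ℝ)) : ℝ × ℝ) (pos v, (level v : ℝ)))
      (openSegment ℝ ((pos u', (level u' : ℝ)) : ℝ × ℝ) (pos v', (level v' : ℝ)))

/-- A graph is leveled planar if it has a leveled planar drawing. -/
def IsLeveledPlanar {V : Type*} (G : SimpleGraph V) : Prop :=
  Nonempty (LeveledPlanarDrawing G)

/-! ### Boundaried graphs and gluing -/

/-- A finite graph with `t` distinct boundary vertices, labeled by `Fin t`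
(the label `i : Fin t` stands for the label `i + 1` of `{1, …, t}`). -/
structure BoundariedGraph (t : ℕ) where
  V : Type
  finite : Finite V
  graph : SimpleGraph V
  boundary : Fin t ↪ V

namespace BoundariedGraph

variable {t : ℕ}

/-- Boundary vertices of `G` and `H` with the same label are identified. -/
inductive GlueRel (G H : BoundariedGraph t) : G.V ⊕ H.V → G.V ⊕ H.V → Prop
  | label (i : Fin t) : GlueRel G H (Sum.inl (G.boundary i)) (Sum.inr (H.boundary i))

/-- The vertex set of the gluing: the disjoint union, with boundary vertices identified. -/
def GlueV (G H : BoundariedGraph t) : Type := Quot (GlueRel G H)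

/-- The vertex of the gluing that comes from a vertex of the left graph. -/
def glueLeft (G H : BoundariedGraph t) (v : G.V) : GlueV G H := Quot.mk _ (Sum.inl v)

/-- The vertex of the gluing that comes from a vertex of the right graph. -/
def glueRight (G H : BoundariedGraph t) (v : H.V) : GlueV G H := Quot.mk _ (Sum.inr v)

theorem glueLeft_injective (G H : BoundariedGraph t) :
    Function.Injective (glueLeft G H) := by
  classical
  let f : G.V ⊕ H.V → Option G.V := fun x => match x with
    | Sum.inl v => some v
    | Sum.inr w => if h : ∃ i, H.boundary i = w then some (G.boundary h.choose) else none
  have hf : ∀ x y, GlueRel G H x y → f x = f y := by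
    rintro _ _ ⟨i⟩
    have h : ∃ j, H.boundary j = H.boundary i := ⟨i, rfl⟩
    have hi : h.choose = i := H.boundary.injective h.choose_spec
    simp only [f, dif_pos h, hi]
  intro u v huv
  have h := congrArg (Quot.lift f hf) huv
  exact Option.some.inj h

/-- The gluing `G ⊕ H`: the edges are those of `G` and those of `H`. (As `boundary` is injective,
no loops arise; parallel edges are merged.) It keeps the boundary labels. -/
def glue (G H : BoundariedGraph t) : BoundariedGraph t where
  V := GlueV G H
  finite := by
    have := G.finite
    have := H.finite
    exact inferInstanceAs (Finite (Quot (GlueRel G H)))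
  graph := SimpleGraph.fromRel fun x y =>
    (∃ u v, G.graph.Adj u v ∧ x = glueLeft G H u ∧ y = glueLeft G H v) ∨
    (∃ u v, H.graph.Adj u v ∧ x = glueRight G H u ∧ y = glueRight G H v)
  boundary := ⟨fun i => glueLeft G H (G.boundary i),
    (glueLeft_injective G H).comp G.boundary.injective⟩

/-! ### The standard operators -/

/-- The nullary operator: `t` isolated vertices, labeled `1, …, t`. -/
def empty (t : ℕ) : BoundariedGraph t where
  V := Fin t
  finite := inferInstance
  graph := ⊥
  boundary := Function.Embedding.refl _

/-- Permute the labels. -/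
def relabel (σ : Equiv.Perm (Fin t)) (G : BoundariedGraph t) : BoundariedGraph t where
  V := G.V
  finite := G.finite
  graph := G.graph
  boundary := σ.toEmbedding.trans G.boundary

/-- Join the vertices labeled `1` and `2` by an edge. -/
def addEdge (G : BoundariedGraph t) : BoundariedGraph t where
  V := G.V
  finite := G.finite
  graph := G.graph ⊔ SimpleGraph.fromRel fun x y =>
    ∃ i j : Fin t, (i : ℕ) = 0 ∧ (j : ℕ) = 1 ∧ x = G.boundary i ∧ y = G.boundary j
  boundary := G.boundary

/-- Add a new isolated vertex and give it the label `1`; the vertex that had the label `1` stays in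
the graph, without a label. -/
def newVertex (G : BoundariedGraph t) : BoundariedGraph t where
  V := Option G.V
  finite := by
    have := G.finite
    infer_instance
  graph := SimpleGraph.fromRel fun x y => ∃ u v, G.graph.Adj u v ∧ x = some u ∧ y = some v
  boundary := ⟨fun i => if (i : ℕ) = 0 then none else some (G.boundary i), by
    intro i j h
    by_cases hi : (i : ℕ) = 0 <;> by_cases hj : (j : ℕ) = 0
    · exact Fin.ext (hi.trans hj.symm)
    · simp [hi, hj] at h
    · simp [hi, hj] at h
    · simpa [hi, hj] using h⟩

end BoundariedGraph

/-- The transposition of the labels `1` and `2` (the identity if there are fewer than two labels). -/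
def swapFirstTwo (t : ℕ) : Equiv.Perm (Fin t) :=
  if h : 1 < t then Equiv.swap ⟨0, by omega⟩ ⟨1, h⟩ else Equiv.refl _

/-- The names of the unary standard operators. -/
inductive UnaryOp : Type
  | rotate
  | swap
  | edge
  | vertex

/-- The meaning of the unary operators: shift the labels cyclically, interchange the labels
`1` and `2`, add an edge between the vertices labeled `1` and `2`, add a new isolated vertex
with label `1`. -/
def UnaryOp.apply {t : ℕ} : UnaryOp → BoundariedGraph t → BoundariedGraph t
  | .rotate, G => G.relabel (finRotate t)
  | .swap, G => G.relabel (swapFirstTwo t)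
  | .edge, G => G.addEdge
  | .vertex, G => G.newVertex

/-! ### Parse trees, tree automata, finite state families -/

/-- Parse trees: finite trees whose nodes carry standard operators. -/
inductive ParseTree : Type
  | empty : ParseTree
  | unary : UnaryOp → ParseTree → ParseTree
  | glue : ParseTree → ParseTree → ParseTree

/-- The `t`-boundaried graph generated by a parse tree. The graphs `T.eval t` are the
small universe of `t`-boundaried graphs. -/
def ParseTree.eval (t : ℕ) : ParseTree → BoundariedGraph t
  | .empty => BoundariedGraph.empty t
  | .unary o T => o.apply (T.eval t)
  | .glue T₁ T₂ => (T₁.eval t).glue (T₂.eval t)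

/-- A (nondeterministic, bottom-up) finite tree automaton over parse trees. The
deterministic ones are those all of whose transition sets are singletons. -/
structure TreeAutomaton where
  State : Type
  finite : Finite State
  onEmpty : Set State
  onUnary : UnaryOp → State → Set State
  onGlue : State → State → Set State
  final : Set State

/-- The states that the automaton can reach at the root of a parse tree. -/
def TreeAutomaton.reach (A : TreeAutomaton) : ParseTree → Set A.State
  | .empty => A.onEmpty
  | .unary o T => {s | ∃ r ∈ A.reach T, s ∈ A.onUnary o r}
  | .glue T₁ T₂ => {s | ∃ r₁ ∈ A.reach T₁, ∃ r₂ ∈ A.reach T₂, s ∈ A.onGlue r₁ r₂}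

/-- The automaton accepts a parse tree if some run ends in a final state. -/
def TreeAutomaton.Accepts (A : TreeAutomaton) (T : ParseTree) : Prop :=
  ∃ s ∈ A.reach T, s ∈ A.final

/-- A family `F` of graphs is `t`-finite state if the set of the parse trees that generate
(`t`-boundaried) graphs in `F` is recognized by a finite tree automaton. -/
def IsFiniteState (t : ℕ) (F : ∀ V : Type, SimpleGraph V → Prop) : Prop :=
  ∃ A : TreeAutomaton, ∀ T : ParseTree, A.Accepts T ↔ F (T.eval t).V (T.eval t).graph

/-! ### Counting monadic second-order logic of graphs with edge set quantification -/

/-- Formulas of counting monadic second-order logic over the incidence structure of a graph, whose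
elements are the vertices and the edges, with `m` free element variables and `n` free set
variables: `x` is a vertex, `x` is a vertex on the edge `y`, `x = y`, `x ∈ X`, `|X| ≡ r (mod q)`,
negation, conjunction, quantification over elements and over sets. -/
inductive CMSO : ℕ → ℕ → Type
  | isVertex {m n : ℕ} (x : Fin m) : CMSO m n
  | inc {m n : ℕ} (x y : Fin m) : CMSO m n
  | eq {m n : ℕ} (x y : Fin m) : CMSO m n
  | mem {m n : ℕ} (x : Fin m) (X : Fin n) : CMSO m n
  | card {m n : ℕ} (q r : ℕ) (hq : 0 < q) (X : Fin n) : CMSO m n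
  | not {m n : ℕ} (φ : CMSO m n) : CMSO m n
  | and {m n : ℕ} (φ ψ : CMSO m n) : CMSO m n
  | exElem {m n : ℕ} (φ : CMSO (m + 1) n) : CMSO m n
  | exSet {m n : ℕ} (φ : CMSO m (n + 1)) : CMSO m n

/-- Truth of a formula in a graph `G`, for the values `a` of the element variables and `S` of the
set variables. -/
def CMSO.Holds {V : Type} (G : SimpleGraph V) : {m n : ℕ} → CMSO m n →
    (Fin m → V ⊕ G.edgeSet) → (Fin n → Set (V ⊕ G.edgeSet)) → Prop
  | _, _, .isVertex x, a, _ => ∃ v : V, a x = Sum.inl v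
  | _, _, .inc x y, a, _ => ∃ (v : V) (e : G.edgeSet),
      a x = Sum.inl v ∧ a y = Sum.inr e ∧ v ∈ (e : Sym2 V)
  | _, _, .eq x y, a, _ => a x = a y
  | _, _, .mem x X, a, S => a x ∈ S X
  | _, _, .card q r _ X, _, S => (S X).ncard ≡ r [MOD q]
  | _, _, .not φ, a, S => ¬ φ.Holds G a S
  | _, _, .and φ ψ, a, S => φ.Holds G a S ∧ ψ.Holds G a S
  | _, _, .exElem φ, a, S => ∃ z : V ⊕ G.edgeSet, φ.Holds G (Fin.cons z a) S
  | _, _, .exSet φ, a, S => ∃ Z : Set (V ⊕ G.edgeSet), φ.Holds G a (Fin.cons Z S)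

/-- A sentence is true in `G`. -/
def CMSO.Models {V : Type} (G : SimpleGraph V) (φ : CMSO 0 0) : Prop :=
  φ.Holds G Fin.elim0 Fin.elim0

/-! Leveled planarity forces a bounded-size boundary to remember an unbounded number, namely the
difference in level of two boundary vertices.

Two vertices with three common neighbors cannot share a level: two of the neighbors would share a
level as well, and two edges would cross (`level_ne_of_three_common_neighbors`). Chaining such
`K_{2,3}` blocks gives a rigid strip. Each block forces the next spine vertex onto the far side of
the previous one, so the `n`-th strip pulls the labels `6` and `2` at least `n` levels apart, and it
has a drawing on `n + 3` levels. A path of length `N` keeps its ends at most `N` levels apart.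
Gluing strip and path along these labels is therefore impossible in a leveled planar way if `N < n`
(`not_isLeveledPlanar_glue`), and possible if `N = n + 2`, with the path drawn beside the strip
(`isLeveledPlanar_glue`). Both families use boundedly many labels, so parse trees generate them.

This is a Myhill–Nerode argument: infinitely many strips are pairwise separated by paths, so no
invariant of the left factor with finitely many values decides the gluing. A tree automaton supplies
such an invariant, the set of reachable states. A sentence of counting monadic second-order logic
supplies another, by a Feferman–Vaught composition argument for the incidence structure of a gluing
(`exists_finite_type`, `exists_finite_class`). -/

/-! ### Leveled drawings: integer placements and crossings -/

theorem mem_openSegment_prod {x y x' y' : ℝ} {P : ℝ × ℝ} (h : P ∈ openSegment ℝ (x, y) (x', y')) :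
    ∃ s : ℝ, 0 < s ∧ s < 1 ∧ P.1 = x + s * (x' - x) ∧ P.2 = y + s * (y' - y) := by
  obtain ⟨a, b, ha, hb, hab, rfl⟩ := h
  refine ⟨b, hb, by linarith, ?_, ?_⟩ <;>
  · simp only [Prod.smul_mk, Prod.mk_add_mk, smul_eq_mul]
    rw [← eq_sub_iff_add_eq] at hab
    rw [hab]
    ring

/-- A placement of the vertices on integer levels in which no two edges between the same two
consecutive levels are in opposite orders is a leveled planar drawing. -/
theorem isLeveledPlanar_of_placement {V : Type*} {G : SimpleGraph V} (lev pos : V → ℤ)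
    (inj : ∀ u v, lev u = lev v → pos u = pos v → u = v)
    (adj : ∀ u v, G.Adj u v → |lev u - lev v| = 1)
    (order : ∀ u v u' v', G.Adj u v → G.Adj u' v' → lev v = lev u + 1 → lev v' = lev u' + 1 →
      lev u = lev u' → pos u < pos u' → pos v ≤ pos v') : IsLeveledPlanar G := by
  have up : ∀ u v, G.Adj u v → ∃ a b, G.Adj a b ∧ lev b = lev a + 1 ∧ s(u, v) = s(a, b) ∧
      openSegment ℝ (((pos u : ℝ), (lev u : ℝ)) : ℝ × ℝ) ((pos v : ℝ), (lev v : ℝ)) =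
      openSegment ℝ (((pos a : ℝ), (lev a : ℝ)) : ℝ × ℝ) ((pos b : ℝ), (lev b : ℝ)) := by
    intro u v h
    rcases (abs_eq (by norm_num)).1 (adj u v h) with h1 | h1
    · exact ⟨v, u, h.symm, by omega, Sym2.eq_swap, openSegment_symm _ _ _⟩
    · exact ⟨u, v, h, by omega, rfl, rfl⟩
  refine ⟨⟨lev, fun v => pos v, adj, ?_, ?_, ?_⟩⟩
  · intro u v h
    simp only [Prod.mk.injEq, Int.cast_inj] at h
    exact inj u v h.2 h.1
  · intro u v w h hw
    obtain ⟨a, b, -, hl, -, he⟩ := up u v h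
    rw [he] at hw
    obtain ⟨s, hs, hs', -, h2⟩ := mem_openSegment_prod hw
    simp only [hl, Int.cast_add, Int.cast_one] at h2
    have h3 : (lev a : ℝ) < lev w := by nlinarith
    have h4 : (lev w : ℝ) < ((lev a + 1 : ℤ) : ℝ) := by push_cast; nlinarith
    have h5 := Int.cast_lt.1 h3
    have h6 := Int.cast_lt.1 h4
    omega
  · intro u v u' v' h h' hne
    obtain ⟨a, b, hab, hl, hs, he⟩ := up u v h
    obtain ⟨a', b', hab', hl', hs', he'⟩ := up u' v' h'
    rw [he, he', Set.disjoint_left]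
    rw [hs, hs'] at hne
    intro P hP hP'
    obtain ⟨s, s0, s1, hx, hy⟩ := mem_openSegment_prod hP
    obtain ⟨s', s0', s1', hx', hy'⟩ := mem_openSegment_prod hP'
    simp only [hl, hl', Int.cast_add, Int.cast_one] at hy hy'
    -- A common interior point lies strictly between the levels of either edge, so both edges join
    -- the same two levels and reach the point at the same parameter.
    have h3 : (lev a : ℝ) < ((lev a' + 1 : ℤ) : ℝ) := by push_cast; linarith
    have h4 : (lev a' : ℝ) < ((lev a + 1 : ℤ) : ℝ) := by push_cast; linarith
    have h5 := Int.cast_lt.1 h3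
    have h6 := Int.cast_lt.1 h4
    have hlev : lev a = lev a' := by omega
    have hss : s = s' := by rw [hlev] at hy; linarith
    subst hss
    rcases lt_trichotomy (pos a) (pos a') with hlt | heq | hlt
    · have := order a b a' b' hab hab' hl hl' hlev hlt
      have h7 : (pos a : ℝ) < pos a' := Int.cast_lt.2 hlt
      have h8 : (pos b : ℝ) ≤ pos b' := Int.cast_le.2 this
      nlinarith
    · have hp : pos b = pos b' := by
        have h9 : s * ((pos b : ℝ) - pos b') = 0 := by rw [heq] at hx; linarith
        rcases mul_eq_zero.1 h9 with h9 | h9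
        · exact absurd h9 s0.ne'
        · exact Int.cast_injective (α := ℝ) (by linarith)
      exact hne (by rw [inj a a' hlev heq, inj b b' (by omega) hp])
    · have := order a' b' a b hab' hab hl' hl hlev.symm hlt
      have h7 : (pos a' : ℝ) < pos a := Int.cast_lt.2 hlt
      have h8 : (pos b' : ℝ) ≤ pos b := Int.cast_le.2 this
      nlinarith

namespace LeveledPlanarDrawing

variable {V : Type*} {G : SimpleGraph V} (D : LeveledPlanarDrawing G)

theorem not_crossing {a e x y : V} (hay : G.Adj a y) (hex : G.Adj e x) (hae : D.level a = D.level e)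
    (hxy : D.level x = D.level y) (h1 : D.pos a < D.pos e) (h2 : D.pos x < D.pos y) : False := by
  have hne : s(a, y) ≠ s(e, x) := by
    intro h
    rcases Sym2.eq_iff.1 h with ⟨rfl, -⟩ | ⟨rfl, rfl⟩
    · exact lt_irrefl _ h1
    · have := D.level_adj _ _ hay
      rw [← hae, sub_self] at this
      norm_num at this
  -- Both edges are at the same height at the same parameter `s`; equating `a + s (y - a)` with `e +
  -- s (x - e)` gives `s = (e - a) / d`.
  set d : ℝ := (D.pos e - D.pos a) + (D.pos y - D.pos x) with hd
  have hd0 : 0 < d := by linarith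
  refine Set.not_disjoint_iff.2 ⟨AffineMap.lineMap ((D.pos a, (D.level a : ℝ)) : ℝ × ℝ)
    (D.pos y, (D.level y : ℝ)) ((D.pos e - D.pos a) / d), ?_, ?_⟩
    (D.edges_disjoint _ _ _ _ hay hex hne)
  · rw [openSegment_eq_image_lineMap]
    exact ⟨_, ⟨div_pos (by linarith) hd0, (div_lt_one hd0).2 (by linarith)⟩, rfl⟩
  · rw [openSegment_eq_image_lineMap]
    refine ⟨(D.pos e - D.pos a) / d, ⟨div_pos (by linarith) hd0, (div_lt_one hd0).2 (by linarith)⟩,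
      ?_⟩
    rw [AffineMap.lineMap_apply, AffineMap.lineMap_apply, hae, hxy]
    ext
    · simp only [vsub_eq_sub, Prod.mk_sub_mk, Prod.smul_mk, smul_eq_mul, vadd_eq_add,
        Prod.mk_add_mk]
      field_simp
      rw [hd]
      ring
    · simp

/-- The source of all rigidity. On a common level, `a` and `e` would have their three neighbors on
the two adjacent levels, hence two on one level. Those two, with `a` and `e`, form a `K_{2,2}`
between two lines, which has a crossing in every order. -/
theorem level_ne_of_three_common_neighbors {a e : V} (x : Fin 3 → V) (hx : Function.Injective x)
    (hae : a ≠ e) (ha : ∀ i, G.Adj a (x i)) (he : ∀ i, G.Adj e (x i)) :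
    D.level a ≠ D.level e := by
  intro hl
  have two : ∀ i j, i ≠ j → D.level (x i) ≠ D.level (x j) := by
    intro i j hij hlx
    have point : ∀ {u v : V}, u ≠ v → D.level u = D.level v → D.pos u ≠ D.pos v := by
      intro u v huv h h'
      exact huv (D.point_injective (by simp [h, h']))
    rcases (point hae hl).lt_or_gt with h1 | h1 <;>
    rcases (point (hx.ne hij) hlx).lt_or_gt with h2 | h2
    · exact D.not_crossing (ha j) (he i) hl hlx h1 h2
    · exact D.not_crossing (ha i) (he j) hl hlx.symm h1 h2
    · exact D.not_crossing (he j) (ha i) hl.symm hlx h1 h2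
    · exact D.not_crossing (he i) (ha j) hl.symm hlx.symm h1 h2
  have h0 := (abs_eq (by norm_num)).1 (D.level_adj _ _ (ha 0))
  have h1 := (abs_eq (by norm_num)).1 (D.level_adj _ _ (ha 1))
  have h2 := (abs_eq (by norm_num)).1 (D.level_adj _ _ (ha 2))
  have := two 0 1 (by decide)
  have := two 0 2 (by decide)
  have := two 1 2 (by decide)
  omega

end LeveledPlanarDrawing

/-! ### Operations derived from the standard operators -/

namespace BoundariedGraph

variable {t : ℕ}

/-- Add an edge between the vertices labeled `i` and `j`. -/
def addEdgeAt (i j : Fin t) (G : BoundariedGraph t) : BoundariedGraph t where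
  V := G.V
  finite := G.finite
  graph := G.graph ⊔ SimpleGraph.fromRel fun x y => x = G.boundary i ∧ y = G.boundary j
  boundary := G.boundary

/-- Add a new vertex that takes over the label `i` and is joined to the vertices which have
the labels in `J`. -/
def joinNew (i : Fin t) (J : Finset (Fin t)) (G : BoundariedGraph t) : BoundariedGraph t where
  V := Option G.V
  finite := by
    have := G.finite
    infer_instance
  graph := SimpleGraph.fromRel fun x y => (∃ u v, G.graph.Adj u v ∧ x = some u ∧ y = some v) ∨
    ∃ j ∈ J, x = none ∧ y = some (G.boundary j)
  boundary := ⟨fun j => if j = i then none else some (G.boundary j), by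
    intro j k h
    by_cases hj : j = i <;> by_cases hk : k = i
    · exact hj.trans hk.symm
    · simp [hj, hk] at h
    · simp [hj, hk] at h
    · simpa [hj, hk] using h⟩

theorem joinNew_boundary_self (i : Fin t) (J : Finset (Fin t)) (G : BoundariedGraph t) :
    (G.joinNew i J).boundary i = none := if_pos rfl

theorem joinNew_boundary_of_ne {i j : Fin t} (h : j ≠ i) (J : Finset (Fin t))
    (G : BoundariedGraph t) : (G.joinNew i J).boundary j = some (G.boundary j) := if_neg h

theorem joinNew_adj_some (i : Fin t) (J : Finset (Fin t)) (G : BoundariedGraph t) (u v : G.V) :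
    (G.joinNew i J).graph.Adj (some u) (some v) ↔ G.graph.Adj u v := by
  simp only [joinNew, SimpleGraph.fromRel_adj]
  constructor
  · rintro ⟨-, (⟨a, b, h, h1, h2⟩ | ⟨j, -, h, -⟩) | ⟨a, b, h, h1, h2⟩ | ⟨j, -, h, -⟩⟩
    · cases h1; cases h2; exact h
    · cases h
    · cases h1; cases h2; exact h.symm
    · cases h
  · intro h
    exact ⟨fun e => h.ne (Option.some.inj e), .inl (.inl ⟨u, v, h, rfl, rfl⟩)⟩

theorem joinNew_adj_none (i : Fin t) (J : Finset (Fin t)) (G : BoundariedGraph t) (v : G.V) :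
    (G.joinNew i J).graph.Adj none (some v) ↔ ∃ j ∈ J, v = G.boundary j := by
  refine (SimpleGraph.fromRel_adj _ _ _).trans ?_
  constructor
  · rintro ⟨-, (⟨a, b, h, h1, h2⟩ | ⟨j, hj, -, h⟩) | ⟨a, b, h, h1, h2⟩ | ⟨j, -, h, -⟩⟩
    · cases h1
    · exact ⟨j, hj, Option.some.inj h⟩
    · cases h2
    · cases h
  · rintro ⟨j, hj, h⟩
    exact ⟨nofun, .inl (.inr ⟨j, hj, rfl, congrArg some h⟩)⟩

/-- The boundaried graph is generated by a parse tree. -/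
def Generated (G : BoundariedGraph t) : Prop := ∃ T : ParseTree, T.eval t = G

theorem generated_empty : Generated (empty t) := ⟨.empty, rfl⟩

theorem Generated.unary {G : BoundariedGraph t} (h : G.Generated) (o : UnaryOp) :
    (o.apply G).Generated := by
  obtain ⟨T, rfl⟩ := h
  exact ⟨.unary o T, rfl⟩

theorem closure_rotate_swap (ht : 2 ≤ t) :
    Subgroup.closure {finRotate t, swapFirstTwo t} = ⊤ := by
  obtain ⟨s, rfl⟩ : ∃ s, t = s + 2 := ⟨t - 2, by omega⟩
  have h := Equiv.Perm.closure_cycle_adjacent_swap (isCycle_finRotate (n := s)) support_finRotate 0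
  rw [← h]
  congr 2

theorem Generated.relabel (ht : 2 ≤ t) {G : BoundariedGraph t} (h : G.Generated)
    (σ : Equiv.Perm (Fin t)) : (G.relabel σ).Generated := by
  have hσ : σ ∈ Subgroup.closure {finRotate t, swapFirstTwo t} := by
    rw [closure_rotate_swap ht]; trivial
  -- In a finite group the generators already generate as a monoid, so no operator for an inverse is
  -- needed.
  rw [← Subgroup.mem_toSubmonoid, Subgroup.closure_toSubmonoid_of_finite] at hσ
  induction hσ using Submonoid.closure_induction generalizing G with
  | mem σ hσ =>
    rcases hσ with rfl | rfl
    · exact h.unary .rotate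
    · exact h.unary .swap
  | one => exact h
  | mul σ τ _ _ h1 h2 => exact h2 (h1 h)

theorem Generated.addEdgeAt (ht : 2 ≤ t) {G : BoundariedGraph t} (h : G.Generated) {i j : Fin t}
    (hij : i ≠ j) : (G.addEdgeAt i j).Generated := by
  obtain ⟨σ, h0, h1⟩ : ∃ σ : Equiv.Perm (Fin t), σ ⟨0, by omega⟩ = i ∧ σ ⟨1, by omega⟩ = j := by
    set τ : Equiv.Perm (Fin t) := Equiv.swap ⟨0, by omega⟩ i
    have h0 : τ ⟨0, by omega⟩ = i := Equiv.swap_apply_left _ _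
    refine ⟨Equiv.swap (τ ⟨1, by omega⟩) j * τ, ?_, by simp⟩
    rw [Equiv.Perm.mul_apply, h0, Equiv.swap_apply_of_ne_of_ne _ hij]
    rw [← h0]
    exact τ.injective.ne (by simp)
  -- Conjugation: bring `i` and `j` to the labels `1` and `2`, add the edge, and restore the labels.
  have := ((h.relabel ht σ).unary .edge).relabel ht σ⁻¹
  convert this using 1
  simp only [BoundariedGraph.addEdgeAt, UnaryOp.apply, BoundariedGraph.relabel, addEdge]
  congr 1
  · congr 2
    ext x y
    constructor
    · rintro ⟨rfl, rfl⟩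
      exact ⟨⟨0, by omega⟩, ⟨1, by omega⟩, rfl, rfl, by simp [h0], by simp [h1]⟩
    · rintro ⟨a, b, ha, hb, hx, hy⟩
      have ea : a = ⟨0, by omega⟩ := Fin.ext ha
      have eb : b = ⟨1, by omega⟩ := Fin.ext hb
      rw [hx, hy, ea, eb]
      simp [h0, h1]
  · ext x
    simp

theorem Generated.joinNew (ht : 2 ≤ t) {G : BoundariedGraph t} (h : G.Generated) {i : Fin t}
    {J : Finset (Fin t)} (hi : i ∉ J) : (G.joinNew i J).Generated := by
  induction J using Finset.induction_on with
  | empty =>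
    set σ : Equiv.Perm (Fin t) := Equiv.swap ⟨0, by omega⟩ i
    have := ((h.relabel ht σ).unary .vertex).relabel ht σ
    convert this using 1
    simp only [BoundariedGraph.joinNew, UnaryOp.apply, BoundariedGraph.relabel, newVertex]
    congr 1
    · congr 1
      ext x y
      simp
    · ext1 x
      have : (σ x : ℕ) = 0 ↔ x = i := by
        rw [← Equiv.apply_eq_iff_eq σ, Equiv.swap_apply_right, Fin.ext_iff]
      change (if x = i then none else some (G.boundary x)) =
        if (σ x : ℕ) = 0 then none else some (G.boundary (σ (σ x)))
      simp only [this]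
      simp [σ]
  | insert j J hj ih =>
    have hij : i ≠ j := fun e => hi (e ▸ Finset.mem_insert_self _ _)
    have := (ih fun h => hi (Finset.mem_insert_of_mem h)).addEdgeAt ht hij
    convert this using 1
    simp only [BoundariedGraph.joinNew, BoundariedGraph.addEdgeAt]
    congr 1
    ext x y
    have hb := joinNew_boundary_of_ne hij.symm J G
    have hn := joinNew_boundary_self i J G
    change _ ↔ (SimpleGraph.fromRel _).Adj _ _ ∨ (SimpleGraph.fromRel _).Adj _ _
    simp only [SimpleGraph.fromRel_adj, Finset.mem_insert]
    constructor
    · rintro ⟨h1, (h2 | ⟨k, rfl | hk, hx, hy⟩) | (h2 | ⟨k, rfl | hk, hx, hy⟩)⟩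
      · exact .inl ⟨h1, .inl (.inl h2)⟩
      · exact .inr ⟨h1, .inl ⟨hx.trans hn.symm, hy.trans hb.symm⟩⟩
      · exact .inl ⟨h1, .inl (.inr ⟨k, hk, hx, hy⟩)⟩
      · exact .inl ⟨h1, .inr (.inl h2)⟩
      · exact .inr ⟨h1, .inr ⟨hx.trans hn.symm, hy.trans hb.symm⟩⟩
      · exact .inl ⟨h1, .inr (.inr ⟨k, hk, hx, hy⟩)⟩
    · rintro (⟨h1, (h2 | ⟨k, hk, hx, hy⟩) | (h2 | ⟨k, hk, hx, hy⟩)⟩ | ⟨h1, ⟨hx, hy⟩ | ⟨hx, hy⟩⟩)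
      · exact ⟨h1, .inl (.inl h2)⟩
      · exact ⟨h1, .inl (.inr ⟨k, .inr hk, hx, hy⟩)⟩
      · exact ⟨h1, .inr (.inl h2)⟩
      · exact ⟨h1, .inr (.inr ⟨k, .inr hk, hx, hy⟩)⟩
      · exact ⟨h1, .inl (.inr ⟨j, .inl rfl, hx.trans hn, hy.trans hb⟩)⟩
      · exact ⟨h1, .inr (.inr ⟨j, .inl rfl, hx.trans hn, hy.trans hb⟩)⟩

/-! ### Placements in the integer grid and rigid strips -/

/-- An injective placement of the vertices in `ℤ × ℤ` (level and position) all of whose edges are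
allowed by the relation `R`. -/
structure IsPlacement (R : ℤ × ℤ → ℤ × ℤ → Prop) (G : BoundariedGraph t) (φ : G.V → ℤ × ℤ) :
    Prop where
  injective : Function.Injective φ
  adj : ∀ u v, G.graph.Adj u v → R (φ u) (φ v) ∨ R (φ v) (φ u)

/-- Extend a placement to a new vertex at `x`. -/
def extend {G : BoundariedGraph t} (i : Fin t) (J : Finset (Fin t)) (φ : G.V → ℤ × ℤ) (x : ℤ × ℤ) :
    (G.joinNew i J).V → ℤ × ℤ := fun v => Option.elim v x φ

theorem IsPlacement.joinNew {R : ℤ × ℤ → ℤ × ℤ → Prop} {G : BoundariedGraph t} {φ : G.V → ℤ × ℤ}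
    (h : IsPlacement R G φ) (i : Fin t) (J : Finset (Fin t)) (x : ℤ × ℤ) (hx : ∀ v, φ v ≠ x)
    (hJ : ∀ j ∈ J, R x (φ (G.boundary j)) ∨ R (φ (G.boundary j)) x) :
    IsPlacement R (G.joinNew i J) (extend i J φ x) where
  injective := by
    rintro (_ | u) (_ | v) huv
    · rfl
    · exact absurd huv.symm (hx v)
    · exact absurd huv (hx u)
    · exact congrArg some (h.injective huv)
  adj := by
    have key : ∀ v, (G.joinNew i J).graph.Adj none (some v) → R x (φ v) ∨ R (φ v) x := by
      intro v hv
      obtain ⟨j, hj, rfl⟩ := (joinNew_adj_none ..).1 hv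
      exact hJ j hj
    rintro (_ | u) (_ | v) huv
    · exact absurd huv (SimpleGraph.irrefl _)
    · exact key v huv
    · exact (key u huv.symm).symm
    · exact h.adj u v ((joinNew_adj_some ..).1 huv)

theorem isPlacement_empty (R : ℤ × ℤ → ℤ × ℤ → Prop) {φ : Fin t → ℤ × ℤ}
    (h : Function.Injective φ) : IsPlacement R (empty t) φ := ⟨h, fun _ _ h => h.elim⟩

/-- The label `k + 1`, where there are at least six labels. -/
def lab (ht : 6 ≤ t) (k : Fin 6) : Fin t := Fin.castLE ht k

theorem lab_inj (ht : 6 ≤ t) {j k : Fin 6} : lab ht j = lab ht k ↔ j = k :=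
  (Fin.castLE_injective ht).eq_iff

/-- An edge between two consecutive levels of a rigid strip, drawn around the column `0`. -/
def StripEdge (P Q : ℤ × ℤ) : Prop :=
  0 ≤ P.1 ∧ Q.1 = P.1 + 1 ∧ (P.1 = 0 → P.2 = 0) ∧ (P.2 = 0 ∨ Q.2 = 0) ∧ P.2 < 10 ∧ Q.2 < 10 ∧
    (Even P.1 → P.2 ≤ 0 ∧ 0 ≤ Q.2) ∧ (¬ Even P.1 → 0 ≤ P.2 ∧ Q.2 ≤ 0)

/-- An edge between two consecutive levels of a rigid strip with `N + 1` levels, or of a path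
drawn next to it in the column `10`. -/
def HostEdge (N : ℤ) (P Q : ℤ × ℤ) : Prop :=
  0 ≤ P.1 ∧ Q.1 = P.1 + 1 ∧ Q.1 ≤ N ∧ (P.1 = 0 → P.2 = 0) ∧ (Q.1 = N → Q.2 = 0) ∧
    (0 < P.1 → Q.1 < N → StripEdge P Q ∨ (P.2 = 10 ∧ Q.2 = 10))

/-- At the first and last level all edges meet in one point of column `0`. In between, the strip
edges form two fans with apex in column `0`, one upward and one downward, on opposite sides, so they
are in monotone order. The path in column `10` is to the right of all of them. -/
theorem HostEdge.not_crossing {N : ℤ} {P Q P' Q' : ℤ × ℤ} (h : HostEdge N P Q)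
    (h' : HostEdge N P' Q') (h1 : P.1 = P'.1) (h2 : P.2 < P'.2) : Q.2 ≤ Q'.2 := by
  obtain ⟨a1, a2, a3, a4, a5, a6⟩ := h
  obtain ⟨b1, b2, b3, b4, b5, b6⟩ := h'
  unfold StripEdge at a6 b6
  rw [← h1] at b1 b2 b4 b6
  by_cases e0 : P.1 = 0
  · have := a4 e0
    have := b4 e0
    omega
  by_cases eN : Q.1 = N
  · have := a5 eN
    have := b5 (by omega)
    omega
  have a7 := a6 (by omega) (by omega)
  have b7 := b6 (by omega) (by omega)
  by_cases hE : Even P.1 <;> simp only [hE, not_true, not_false_eq_true, true_implies, false_implies,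
    and_true, true_and] at a7 b7 <;> omega

/-- In every leveled drawing of every graph that contains `G`, the labels `1` and `2` are on
consecutive levels and the label `2` is at least `n` levels from the label `6`, in the direction of
the step from the label `1`. -/
def ForcesDistance (ht : 6 ≤ t) (n : ℤ) (G : BoundariedGraph t) : Prop :=
  G.graph.Adj (G.boundary (lab ht 0)) (G.boundary (lab ht 1)) ∧
  ∀ (W : Type) (H : SimpleGraph W) (D : LeveledPlanarDrawing H) (f : G.graph →g H),
    Function.Injective f → ∃ ε : ℤ, (ε = 1 ∨ ε = -1) ∧
      D.level (f (G.boundary (lab ht 1))) - D.level (f (G.boundary (lab ht 0))) = ε ∧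
      n ≤ ε * (D.level (f (G.boundary (lab ht 1))) - D.level (f (G.boundary (lab ht 5))))

/-- The strip with levels `0, …, n + 2`, whose first vertex has the label `6` and whose two last
vertices have the labels `1` and `2`. -/
def IsStrip (ht : 6 ≤ t) (n : ℕ) (G : BoundariedGraph t) : Prop :=
  ForcesDistance ht n G ∧ ∃ φ : G.V → ℤ × ℤ, IsPlacement StripEdge G φ ∧
    φ (G.boundary (lab ht 5)) = (0, 0) ∧ φ (G.boundary (lab ht 0)) = ((n : ℤ) + 1, 0) ∧
    φ (G.boundary (lab ht 1)) = ((n : ℤ) + 2, 0) ∧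
    ∀ v, (φ v = ((n : ℤ) + 2, 0) ∨ (φ v).1 ≤ n + 1) ∧ (φ v).2 < 10

/-- The start is a path with two edges. Nothing prevents it from folding back to its first level, so
it guarantees only distance `0` while its drawing spans two steps; this slack of two stays with all
strips. -/
theorem exists_isStrip_zero (ht : 6 ≤ t) : ∃ G, Generated G ∧ IsStrip ht 0 G := by
  set G₁ := (empty t).joinNew (lab ht 0) {lab ht 5}
  set G₂ := G₁.joinNew (lab ht 1) {lab ht 0}
  have b0 : G₂.boundary (lab ht 0) = some none := by
    exact (joinNew_boundary_of_ne (by simp [lab_inj]) ..).trans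
      (congrArg some (joinNew_boundary_self ..))
  have b1 : G₂.boundary (lab ht 1) = none := joinNew_boundary_self ..
  have b5 : G₂.boundary (lab ht 5) = some (some (lab ht 5)) := by
    exact (joinNew_boundary_of_ne (by simp [lab_inj]) ..).trans
      (congrArg some (joinNew_boundary_of_ne (by simp [lab_inj]) ..))
  have a01 : G₂.graph.Adj none (some none) :=
    (joinNew_adj_none ..).2 ⟨lab ht 0, by simp, (joinNew_boundary_self ..).symm⟩
  have a05 : G₂.graph.Adj (some none) (some (some (lab ht 5))) :=
    (joinNew_adj_some ..).2 ((joinNew_adj_none ..).2 ⟨lab ht 5, by simp, rfl⟩)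
  refine ⟨G₂, (generated_empty.joinNew (by omega) (by simp [lab_inj])).joinNew (by omega)
    (by simp [lab_inj]), ⟨by rw [b0, b1]; exact a01.symm, ?_⟩, ?_⟩
  · intro W H D f hf
    rw [b0, b1, b5]
    have h1 := (abs_eq (by norm_num)).1 (D.level_adj _ _ (f.map_adj a01))
    have h2 := (abs_eq (by norm_num)).1 (D.level_adj _ _ (f.map_adj a05))
    change D.level (f none) - D.level (f (some none)) = 1 ∨
      D.level (f none) - D.level (f (some none)) = -1 at h1
    change D.level (f (some none)) - D.level (f (some (some (lab ht 5)))) = 1 ∨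
      D.level (f (some none)) - D.level (f (some (some (lab ht 5)))) = -1 at h2
    change ∃ ε : ℤ, (ε = 1 ∨ ε = -1) ∧ D.level (f none) - D.level (f (some none)) = ε ∧
      _ ≤ ε * (D.level (f none) - D.level (f (some (some (lab ht 5)))))
    rcases h1 with h1 | h1
    · exact ⟨1, .inl rfl, h1, by push_cast; omega⟩
    · exact ⟨-1, .inr rfl, h1, by push_cast; omega⟩
  -- The other initial vertices go to distinct negative levels, away from the places of all later
  -- vertices.
  · let φ : Fin t → ℤ × ℤ := fun i => if i = lab ht 5 then (0, 0) else (-1 - (i : ℤ), 0)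
    have hφ : Function.Injective φ := by
      intro i j hij
      by_cases hi : i = lab ht 5 <;> by_cases hj : j = lab ht 5 <;>
        simp only [φ, hi, hj, if_true, if_false, Prod.mk.injEq, and_true] at hij ⊢
      · omega
      · omega
      · exact Fin.ext (by omega)
    have hle : ∀ i, (φ i).1 ≤ 0 ∧ (φ i).2 = 0 := by
      intro i
      simp only [φ]
      split_ifs <;> simp
    have h5 : φ (lab ht 5) = (0, 0) := if_pos rfl
    have p1 := (isPlacement_empty StripEdge hφ).joinNew (lab ht 0) {lab ht 5} (1, 0)
      (fun v h => by have := (hle v).1; rw [h] at this; norm_num at this)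
      (by
        intro j hj
        rw [Finset.mem_singleton.1 hj]
        right
        change StripEdge (φ (lab ht 5)) _
        simp [StripEdge, h5])
    have p2 := p1.joinNew (lab ht 1) {lab ht 0} (2, 0)
      (by
        rintro (_ | v) h
        · cases h
        · have := (hle v).1
          change φ v = _ at h
          rw [h] at this
          norm_num at this)
      (by
        intro j hj
        rw [Finset.mem_singleton.1 hj, joinNew_boundary_self]
        right
        show StripEdge (1, 0) (2, 0)
        simp [StripEdge])
    refine ⟨_, p2, ?_, ?_, ?_, ?_⟩
    · rw [b5]
      exact h5
    · rw [b0]; rfl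
    · rw [b1]; rfl
    · rintro (_ | _ | v)
      · exact ⟨.inl rfl, by show (0 : ℤ) < 10; norm_num⟩
      · exact ⟨.inr le_rfl, by show (0 : ℤ) < 10; norm_num⟩
      · exact ⟨.inr ((hle v).1.trans (by norm_num)), (hle v).2.trans_lt (by norm_num)⟩

/-- With `a`, `b` labeled `1`, `2`, add two further neighbors `p`, `q` of `a` and a vertex `e`
joined to `b`, `p`, `q`. Then `a` and `e` have three common neighbors and lie on different levels.
Both are adjacent to `b`, so the step from `b` to `e` continues the step from `a` to `b`. -/
theorem IsStrip.exists_succ (ht : 6 ≤ t) {n : ℕ} {G : BoundariedGraph t} (hG : Generated G)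
    (h : IsStrip ht n G) : ∃ G, Generated G ∧ IsStrip ht (n + 1) G := by
  set G₁ := G.joinNew (lab ht 2) {lab ht 0}
  set G₂ := G₁.joinNew (lab ht 3) {lab ht 0}
  set G₃ := G₂.joinNew (lab ht 0) {lab ht 1, lab ht 2, lab ht 3}
  -- The new vertex `e` took the label `1` from `a`; the swap makes `b`, `e` the new last pair.
  set G₄ := G₃.relabel (Equiv.swap (lab ht 0) (lab ht 1))
  set a := G.boundary (lab ht 0)
  set b := G.boundary (lab ht 1)
  have c : ∀ k, k ≠ 0 → k ≠ 2 → k ≠ 3 →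
      G₃.boundary (lab ht k) = some (some (some (G.boundary (lab ht k)))) := by
    intro k h0 h2 h3
    exact (joinNew_boundary_of_ne (by simpa [lab_inj]) ..).trans
      (congrArg some ((joinNew_boundary_of_ne (by simpa [lab_inj]) ..).trans
        (congrArg some (joinNew_boundary_of_ne (by simpa [lab_inj]) ..))))
  have b2 : ∀ k, k ≠ 2 → k ≠ 3 → G₂.boundary (lab ht k) = some (some (G.boundary (lab ht k))) := by
    intro k h2 h3
    exact (joinNew_boundary_of_ne (by simpa [lab_inj]) ..).trans
      (congrArg some (joinNew_boundary_of_ne (by simpa [lab_inj]) ..))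
  have b22 : G₂.boundary (lab ht 2) = some none := by
    exact (joinNew_boundary_of_ne (by simp [lab_inj]) ..).trans
      (congrArg some (joinNew_boundary_self ..))
  have b23 : G₂.boundary (lab ht 3) = none := joinNew_boundary_self ..
  have b10 : G₁.boundary (lab ht 0) = some a := joinNew_boundary_of_ne (by simp [lab_inj]) ..
  have e0 : G₄.boundary (lab ht 0) = some (some (some b)) := by
    change G₃.boundary (Equiv.swap (lab ht 0) (lab ht 1) (lab ht 0)) = _
    rw [Equiv.swap_apply_left, c 1 (by decide) (by decide) (by decide)]
  have e1 : G₄.boundary (lab ht 1) = none := by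
    change G₃.boundary (Equiv.swap (lab ht 0) (lab ht 1) (lab ht 1)) = _
    rw [Equiv.swap_apply_right]
    exact joinNew_boundary_self ..
  have e5 : G₄.boundary (lab ht 5) = some (some (some (G.boundary (lab ht 5)))) := by
    change G₃.boundary (Equiv.swap (lab ht 0) (lab ht 1) (lab ht 5)) = _
    rw [Equiv.swap_apply_of_ne_of_ne (by simp [lab_inj]) (by simp [lab_inj]),
      c 5 (by decide) (by decide) (by decide)]
  have adj_eb : G₃.graph.Adj none (some (some (some b))) :=
    (joinNew_adj_none ..).2 ⟨lab ht 1, by simp, (b2 1 (by decide) (by decide)).symm⟩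
  have adj_ep : G₃.graph.Adj none (some (some none)) :=
    (joinNew_adj_none ..).2 ⟨lab ht 2, by simp, b22.symm⟩
  have adj_eq : G₃.graph.Adj none (some none) :=
    (joinNew_adj_none ..).2 ⟨lab ht 3, by simp, b23.symm⟩
  have adj_qa : G₃.graph.Adj (some none) (some (some (some a))) :=
    (joinNew_adj_some ..).2 ((joinNew_adj_none ..).2 ⟨lab ht 0, by simp, b10.symm⟩)
  have adj_pa : G₃.graph.Adj (some (some none)) (some (some (some a))) :=
    (joinNew_adj_some ..).2 ((joinNew_adj_some ..).2 ((joinNew_adj_none ..).2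
      ⟨lab ht 0, by simp, rfl⟩))
  obtain ⟨⟨hab, force⟩, φ, hφ, h5, h0, h1, hv⟩ := h
  have adj_ab : G₃.graph.Adj (some (some (some a))) (some (some (some b))) :=
    (joinNew_adj_some ..).2 ((joinNew_adj_some ..).2 ((joinNew_adj_some ..).2 hab))
  refine ⟨G₄, (((hG.joinNew (by omega) (by simp [lab_inj])).joinNew (by omega)
    (by simp [lab_inj])).joinNew (by omega) (by simp [lab_inj])).relabel (by omega) _,
    ⟨by rw [e0, e1]; exact adj_eb.symm, ?_⟩, ?_⟩
  · intro W H D f hf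
    let g : G.graph →g H :=
      { toFun := fun v => f (some (some (some v)))
        map_rel' := fun h => f.map_adj
          ((joinNew_adj_some (lab ht 0) ..).2 ((joinNew_adj_some ..).2 ((joinNew_adj_some ..).2 h))) }
    have hg : Function.Injective g := fun u v huv =>
      Option.some.inj (Option.some.inj (Option.some.inj (hf huv)))
    obtain ⟨ε, hε, hab', hn⟩ := force W H D g hg
    rw [e0, e1, e5]
    have key : D.level (f (some (some (some a)))) ≠ D.level (f none) := by
      apply D.level_ne_of_three_common_neighbors
        ![f (some (some (some b))), f (some (some none)), f (some none)]
      · intro i j hij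
        fin_cases i <;> fin_cases j <;> first | rfl | cases hf hij
      · exact fun h => by have := hf h; cases this
      · intro i
        fin_cases i
        · exact f.map_adj adj_ab
        · exact f.map_adj adj_pa.symm
        · exact f.map_adj adj_qa.symm
      · intro i
        fin_cases i
        · exact f.map_adj adj_eb
        · exact f.map_adj adj_ep
        · exact f.map_adj adj_eq
    have hbe := (abs_eq (by norm_num)).1 (D.level_adj _ _ (f.map_adj adj_eb))
    let F : Option (Option (Option G.V)) → ℤ := fun v => D.level (f v)
    change F (some (some (some a))) ≠ F none at key
    change F none - F (some (some (some b))) = 1 ∨ F none - F (some (some (some b))) = -1 at hbe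
    change F (some (some (some b))) - F (some (some (some a))) = ε at hab'
    change _ ≤ ε * (F (some (some (some b))) - F (some (some (some (G.boundary (lab ht 5)))))) at hn
    change ∃ ε : ℤ, (ε = 1 ∨ ε = -1) ∧ F none - F (some (some (some b))) = ε ∧
      _ ≤ ε * (F none - F (some (some (some (G.boundary (lab ht 5))))))
    refine ⟨ε, hε, by omega, ?_⟩
    push_cast
    rcases hε with rfl | rfl <;> omega
  -- The vertices `p`, `q` go to the columns `s`, `2 * s` beside `b`. The side alternates with the
  -- level, since the downward fan from `e` and the next upward fan from `b` share two levels and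
  -- must be on opposite sides.
  · obtain ⟨s, hs, hs0⟩ : ∃ s : ℤ, (s = 1 ∨ s = -1) ∧ ((Even ((n : ℤ) + 1) → s = 1) ∧
        (¬ Even ((n : ℤ) + 1) → s = -1)) := by
      by_cases hE : Even ((n : ℤ) + 1)
      · exact ⟨1, by simp [hE]⟩
      · exact ⟨-1, by simp [hE]⟩
    have hE' : Even ((n : ℤ) + 2) ↔ ¬ Even ((n : ℤ) + 1) := by
      rw [← Int.even_add_one]; ring_nf
    -- By the last clause of `IsStrip`, everything from level `n + 2` upward is free except the
    -- place of `b`.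
    have fresh : ∀ v (x : ℤ × ℤ), n + 2 ≤ x.1 → x ≠ ((n : ℤ) + 2, 0) → φ v ≠ x := by
      rintro v x hx hx' rfl
      rcases (hv v).1 with h | h
      · exact hx' h
      · omega
    have p1 := hφ.joinNew (lab ht 2) {lab ht 0} (n + 2, s)
      (fun v => fresh v _ le_rfl (fun e => by simp only [Prod.mk.injEq] at e; omega)) (by
        intro j hj
        rw [Finset.mem_singleton.1 hj]
        right
        rw [h0]
        unfold StripEdge
        grind)
    have p2 := p1.joinNew (lab ht 3) {lab ht 0} (n + 2, 2 * s)
      (by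
        rintro (_ | v) h
        · have := congrArg Prod.snd h
          change s = 2 * s at this
          omega
        · exact fresh v _ le_rfl (fun e => by simp only [Prod.mk.injEq] at e; omega) h) (by
        intro j hj
        rw [Finset.mem_singleton.1 hj]
        right
        rw [b10]
        change StripEdge (φ a) _
        rw [h0]
        unfold StripEdge
        grind)
    have p3 := p2.joinNew (lab ht 0) {lab ht 1, lab ht 2, lab ht 3} (n + 3, 0)
      (by
        rintro (_ | _ | v) h
        · have := congrArg Prod.fst h
          change (n : ℤ) + 2 = n + 3 at this
          omega
        · have := congrArg Prod.fst h
          change (n : ℤ) + 2 = n + 3 at this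
          omega
        · exact fresh v _ (by show (n : ℤ) + 2 ≤ n + 3; omega)
            (fun e => by simp only [Prod.mk.injEq] at e; omega) h) (by
        intro j hj
        simp only [Finset.mem_insert, Finset.mem_singleton] at hj
        right
        rcases hj with rfl | rfl | rfl
        · rw [b2 1 (by decide) (by decide)]
          change StripEdge (φ b) _
          rw [h1]
          unfold StripEdge
          grind
        · rw [b22]
          change StripEdge (n + 2, s) _
          unfold StripEdge
          grind
        · rw [b23]
          change StripEdge (n + 2, 2 * s) _
          unfold StripEdge
          grind)
    refine ⟨_, ⟨p3.injective, p3.adj⟩, ?_, ?_, ?_, ?_⟩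
    · rw [e5]; exact h5
    · rw [e0]; push_cast; refine Eq.trans h1 ?_; ring_nf
    · rw [e1]; push_cast; show ((n : ℤ) + 3, (0 : ℤ)) = _; ring_nf
    · push_cast
      rintro (_ | _ | _ | v)
      · exact ⟨.inl (by show ((n : ℤ) + 3, (0 : ℤ)) = _; ring_nf), by show (0 : ℤ) < 10; norm_num⟩
      · exact ⟨.inr (by show (n : ℤ) + 2 ≤ _; omega), by show 2 * s < 10; omega⟩
      · exact ⟨.inr (by show (n : ℤ) + 2 ≤ _; omega), by show s < 10; omega⟩
      · obtain ⟨h | h, h'⟩ := hv v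
        · exact ⟨.inr (by show (φ v).1 ≤ _; rw [h]; show (n : ℤ) + 2 ≤ _; omega), h'⟩
        · exact ⟨.inr (by show (φ v).1 ≤ _; omega), h'⟩

theorem exists_isStrip (ht : 6 ≤ t) (n : ℕ) : ∃ G, Generated G ∧ IsStrip ht n G := by
  induction n with
  | zero => exact exists_isStrip_zero ht
  | succ n ih =>
    obtain ⟨G, hG, h⟩ := ih
    exact h.exists_succ ht hG

/-! ### Paths, the test graphs for the strips -/

/-- In every leveled drawing of a homomorphic image of `G`, the labels `k + 1` and `6` are at most
`m` levels apart. -/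
def BoundsDistance (ht : 6 ≤ t) (m : ℤ) (k : Fin 6) (G : BoundariedGraph t) : Prop :=
  ∀ (W : Type) (H : SimpleGraph W) (D : LeveledPlanarDrawing H) (f : G.graph →g H),
    |D.level (f (G.boundary (lab ht k))) - D.level (f (G.boundary (lab ht 5)))| ≤ m

/-- A path of length `m` from the label `6` to the label `1`, the other vertices being isolated
(the label `3` is in use). It is placed in the column `10`, except for its first vertex. -/
def IsOpenPath (ht : 6 ≤ t) (N : ℤ) (m : ℕ) (G : BoundariedGraph t) : Prop :=
  BoundsDistance ht m 0 G ∧ ∃ φ : G.V → ℤ × ℤ, IsPlacement (HostEdge N) G φ ∧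
    φ (G.boundary (lab ht 5)) = (0, 0) ∧ φ (G.boundary (lab ht 0)) = ((m : ℤ), 10) ∧
    (∀ v, v ≠ G.boundary (lab ht 5) → (φ v).1 ≤ m ∧ (φ v).2 = 10) ∧
    ∀ i, i ≠ lab ht 5 → i ≠ lab ht 0 → i ≠ lab ht 2 → ∀ v, ¬ G.graph.Adj (G.boundary i) v

/-- A path of length `N` from the label `6` to the label `2`, the other boundary vertices being
isolated. -/
def IsPath (ht : 6 ≤ t) (N : ℕ) (G : BoundariedGraph t) : Prop :=
  BoundsDistance ht N 1 G ∧ ∃ φ : G.V → ℤ × ℤ, IsPlacement (HostEdge N) G φ ∧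
    φ (G.boundary (lab ht 5)) = (0, 0) ∧ φ (G.boundary (lab ht 1)) = ((N : ℤ), 0) ∧
    (∀ v, (∀ i, v ≠ G.boundary i) → (φ v).2 = 10) ∧
    ∀ i, i ≠ lab ht 5 → i ≠ lab ht 1 → ∀ v, ¬ G.graph.Adj (G.boundary i) v

/-- The restriction to `G` of a homomorphism from `G` with a new vertex. -/
def restrictHom {G : BoundariedGraph t} {i : Fin t} {J : Finset (Fin t)} {W : Type}
    {H : SimpleGraph W} (f : (G.joinNew i J).graph →g H) : G.graph →g H where
  toFun v := f (some v)
  map_rel' h := f.map_adj ((joinNew_adj_some i J ..).2 h)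

theorem joinNew_isolated {G : BoundariedGraph t} {i : Fin t} {J : Finset (Fin t)} {j : Fin t}
    (hj : j ≠ i) (hJ : j ∉ J) (h : ∀ v, ¬ G.graph.Adj (G.boundary j) v) (v : (G.joinNew i J).V) :
    ¬ (G.joinNew i J).graph.Adj ((G.joinNew i J).boundary j) v := by
  rw [joinNew_boundary_of_ne hj]
  rcases v with _ | v
  · intro h'
    obtain ⟨k, hk, e⟩ := (joinNew_adj_none ..).1 h'.symm
    rw [G.boundary.injective e] at hJ
    exact hJ hk
  · exact fun h' => h v ((joinNew_adj_some ..).1 h')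

theorem joinNew_empty_isolated (G : BoundariedGraph t) (i : Fin t) (v : (G.joinNew i ∅).V) :
    ¬ (G.joinNew i ∅).graph.Adj ((G.joinNew i ∅).boundary i) v := by
  rw [joinNew_boundary_self]
  rcases v with _ | v
  · exact SimpleGraph.irrefl _
  · intro h
    obtain ⟨k, hk, -⟩ := (joinNew_adj_none ..).1 h
    simp at hk

theorem exists_isOpenPath_one (ht : 6 ≤ t) {N : ℤ} (hN : 2 ≤ N) :
    ∃ G, Generated G ∧ IsOpenPath ht N 1 G := by
  set G₁ := (empty t).joinNew (lab ht 0) {lab ht 5}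
  have b0 : G₁.boundary (lab ht 0) = none := joinNew_boundary_self ..
  have b5 : G₁.boundary (lab ht 5) = some (lab ht 5) :=
    joinNew_boundary_of_ne (by simp [lab_inj]) ..
  have a05 : G₁.graph.Adj none (some (lab ht 5)) :=
    (joinNew_adj_none ..).2 ⟨lab ht 5, by simp, rfl⟩
  refine ⟨G₁, generated_empty.joinNew (by omega) (by simp [lab_inj]), ?_, ?_⟩
  · intro W H D f
    rw [b0, b5]
    exact (D.level_adj _ _ (f.map_adj a05)).le
  · let φ : Fin t → ℤ × ℤ := fun i => if i = lab ht 5 then (0, 0) else (-1 - (i : ℤ), 10)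
    have hφ : Function.Injective φ := by
      intro i j hij
      by_cases hi : i = lab ht 5 <;> by_cases hj : j = lab ht 5 <;>
        simp only [φ, hi, hj, if_true, if_false, Prod.mk.injEq, and_true] at hij ⊢
      · omega
      · omega
      · exact Fin.ext (by omega)
    have hle : ∀ i, (φ i).1 ≤ 0 ∧ (i ≠ lab ht 5 → (φ i).2 = 10) := by
      intro i
      simp only [φ]
      split_ifs with h <;> simp [h]
    have h5 : φ (lab ht 5) = (0, 0) := if_pos rfl
    have p1 := (isPlacement_empty (HostEdge N) hφ).joinNew (lab ht 0) {lab ht 5} (1, 10)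
      (fun v h => by have := (hle v).1; rw [h] at this; norm_num at this)
      (by
        intro j hj
        rw [Finset.mem_singleton.1 hj]
        right
        change HostEdge N (φ (lab ht 5)) _
        rw [h5]
        unfold HostEdge
        refine ⟨?_, ?_, ?_, ?_, ?_, ?_⟩ <;> simp <;> omega)
    refine ⟨_, p1, ?_, ?_, ?_, ?_⟩
    · rw [b5]; exact h5
    · rw [b0]; rfl
    · rw [b5]
      rintro (_ | v) hv
      · exact ⟨le_rfl, rfl⟩
      · exact ⟨(hle v).1.trans (by norm_num), (hle v).2 fun e => hv (congrArg some e)⟩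
    · intro i h5 h0 _
      exact joinNew_isolated h0 (by simpa) fun v h => h.elim

/-- The new end enters under the label `3` and is swapped with the old end, which loses its label in
the next extension; two labels thus suffice for paths of any length. -/
theorem IsOpenPath.exists_succ (ht : 6 ≤ t) {N : ℤ} {m : ℕ} (hm : 0 < m) (hN : (m : ℤ) + 2 ≤ N)
    {G : BoundariedGraph t} (hG : Generated G) (h : IsOpenPath ht N m G) :
    ∃ G, Generated G ∧ IsOpenPath ht N (m + 1) G := by
  set G₁ := G.joinNew (lab ht 2) {lab ht 0}
  set G₂ := G₁.relabel (Equiv.swap (lab ht 0) (lab ht 2))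
  have b5 : G₂.boundary (lab ht 5) = some (G.boundary (lab ht 5)) := by
    change G₁.boundary (Equiv.swap (lab ht 0) (lab ht 2) (lab ht 5)) = _
    rw [Equiv.swap_apply_of_ne_of_ne (by simp [lab_inj]) (by simp [lab_inj])]
    exact joinNew_boundary_of_ne (by simp [lab_inj]) ..
  have b0 : G₂.boundary (lab ht 0) = none := by
    change G₁.boundary (Equiv.swap (lab ht 0) (lab ht 2) (lab ht 0)) = _
    rw [Equiv.swap_apply_left]
    exact joinNew_boundary_self ..
  have adj : G₁.graph.Adj none (some (G.boundary (lab ht 0))) :=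
    (joinNew_adj_none ..).2 ⟨lab ht 0, by simp, rfl⟩
  obtain ⟨hD, φ, hφ, h5, h0, hv, hi⟩ := h
  refine ⟨G₂, (hG.joinNew (by omega) (by simp [lab_inj])).relabel (by omega) _, ?_, ?_⟩
  · intro W H D f
    have h1 := hD W H D (restrictHom (G := G) (i := lab ht 2) (J := {lab ht 0}) f)
    have h2 := D.level_adj _ _ (f.map_adj adj)
    rw [b0, b5]
    let F : Option G.V → ℤ := fun v => D.level (f v)
    change |F (some (G.boundary (lab ht 0))) - F (some (G.boundary (lab ht 5)))| ≤ _ at h1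
    change |F none - F (some (G.boundary (lab ht 0)))| = 1 at h2
    change |F none - F (some (G.boundary (lab ht 5)))| ≤ _
    push_cast
    rw [abs_le] at h1 ⊢
    rw [abs_eq (by norm_num)] at h2
    omega
  · have p1 := hφ.joinNew (lab ht 2) {lab ht 0} ((m : ℤ) + 1, 10)
      (by
        intro v e
        by_cases hv5 : v = G.boundary (lab ht 5)
        · rw [hv5, h5] at e
          simp at e
        · have := (hv v hv5).1
          rw [e] at this
          simp at this)
      (by
        intro j hj
        rw [Finset.mem_singleton.1 hj]
        right
        rw [h0]
        unfold HostEdge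
        refine ⟨?_, ?_, ?_, ?_, ?_, ?_⟩ <;> simp <;> omega)
    refine ⟨_, ⟨p1.injective, p1.adj⟩, ?_, ?_, ?_, ?_⟩
    · rw [b5]; exact h5
    · rw [b0]; push_cast; rfl
    · rw [b5]
      push_cast
      rintro (_ | v) hv'
      · exact ⟨le_rfl, rfl⟩
      · obtain ⟨h1, h2⟩ := hv v fun e => hv' (congrArg some e)
        exact ⟨h1.trans (by omega), h2⟩
    · intro i i5 i0 i2
      change ∀ v, ¬ G₁.graph.Adj (G₁.boundary (Equiv.swap (lab ht 0) (lab ht 2) i)) v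
      rw [Equiv.swap_apply_of_ne_of_ne i0 i2]
      exact joinNew_isolated i2 (by simpa) (hi i i5 i0 i2)

theorem exists_isOpenPath (ht : 6 ≤ t) (N : ℤ) (m : ℕ) (hN : (m : ℤ) + 2 ≤ N) :
    ∃ G, Generated G ∧ IsOpenPath ht N (m + 1) G := by
  induction m with
  | zero => exact exists_isOpenPath_one ht (by simpa using hN)
  | succ m ih =>
    obtain ⟨G, hG, h⟩ := ih (by push_cast at hN; omega)
    exact h.exists_succ ht (by omega) (by push_cast at hN ⊢; omega) hG

/-- The last vertex leaves column `10` for `(n + 2, 0)`, the place of the last vertex of the strip.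
The labels `1` and `3` are then moved to fresh isolated vertices, so that gluing attaches the path
at its two ends only. -/
theorem exists_isPath (ht : 6 ≤ t) (n : ℕ) : ∃ G, Generated G ∧ IsPath ht (n + 2) G := by
  obtain ⟨G, hG, hD, φ, hφ, h5, h0, hv, hi⟩ := exists_isOpenPath ht (n + 2) n le_rfl
  set G₁ := G.joinNew (lab ht 1) {lab ht 0}
  set G₂ := G₁.joinNew (lab ht 0) ∅
  set G₃ := G₂.joinNew (lab ht 2) ∅
  have b5 : G₃.boundary (lab ht 5) = some (some (some (G.boundary (lab ht 5)))) :=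
    (joinNew_boundary_of_ne (by simp [lab_inj]) ..).trans
      (congrArg some ((joinNew_boundary_of_ne (by simp [lab_inj]) ..).trans
        (congrArg some (joinNew_boundary_of_ne (by simp [lab_inj]) ..))))
  have b1 : G₃.boundary (lab ht 1) = some (some none) :=
    (joinNew_boundary_of_ne (by simp [lab_inj]) ..).trans
      (congrArg some ((joinNew_boundary_of_ne (by simp [lab_inj]) ..).trans
        (congrArg some (joinNew_boundary_self ..))))
  have b0 : G₃.boundary (lab ht 0) = some none :=
    (joinNew_boundary_of_ne (by simp [lab_inj]) ..).trans
      (congrArg some (joinNew_boundary_self ..))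
  have b2 : G₃.boundary (lab ht 2) = none := joinNew_boundary_self ..
  have adj : G₃.graph.Adj (some (some none)) (some (some (some (G.boundary (lab ht 0))))) :=
    (joinNew_adj_some ..).2 ((joinNew_adj_some ..).2 ((joinNew_adj_none ..).2
      ⟨lab ht 0, by simp, rfl⟩))
  refine ⟨G₃, ((hG.joinNew (by omega) (by simp [lab_inj])).joinNew (by omega) (by simp)).joinNew
    (by omega) (by simp), ?_, ?_⟩
  · intro W H D f
    have h1 := hD W H D (restrictHom (restrictHom (restrictHom f)))
    have h2 := D.level_adj _ _ (f.map_adj adj)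
    rw [b1, b5]
    let F : Option (Option (Option G.V)) → ℤ := fun v => D.level (f v)
    change |F (some (some (some (G.boundary (lab ht 0))))) -
      F (some (some (some (G.boundary (lab ht 5)))))| ≤ _ at h1
    change |F (some (some none)) - F (some (some (some (G.boundary (lab ht 0)))))| = 1 at h2
    change |F (some (some none)) - F (some (some (some (G.boundary (lab ht 5)))))| ≤ _
    push_cast at h1 ⊢
    rw [abs_le] at h1 ⊢
    rw [abs_eq (by norm_num)] at h2
    omega
  · have fresh : ∀ v (x : ℤ × ℤ), (n : ℤ) + 2 ≤ x.1 → φ v ≠ x := by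
      rintro v x hx rfl
      by_cases hv5 : v = G.boundary (lab ht 5)
      · rw [hv5, h5] at hx
        change (n : ℤ) + 2 ≤ 0 at hx
        omega
      · have := (hv v hv5).1
        push_cast at this
        omega
    have p1 := hφ.joinNew (lab ht 1) {lab ht 0} ((n : ℤ) + 2, 0) (fun v => fresh v _ le_rfl)
      (by
        intro j hj
        rw [Finset.mem_singleton.1 hj]
        right
        rw [h0]
        unfold HostEdge
        refine ⟨?_, ?_, ?_, ?_, ?_, ?_⟩ <;> simp <;> omega)
    -- These two places matter only for injectivity: in a gluing, the boundary vertices take their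
    -- places from the strip.
    have p2 := p1.joinNew (lab ht 0) ∅ ((n : ℤ) + 3, 0)
      (by
        rintro (_ | v) h
        · have := congrArg Prod.fst h
          change (n : ℤ) + 2 = n + 3 at this
          omega
        · exact fresh v _ (by show (n : ℤ) + 2 ≤ n + 3; omega) h)
      (by simp)
    have p3 := p2.joinNew (lab ht 2) ∅ ((n : ℤ) + 4, 0)
      (by
        rintro (_ | _ | v) h
        · have := congrArg Prod.fst h
          change (n : ℤ) + 3 = n + 4 at this
          omega
        · have := congrArg Prod.fst h
          change (n : ℤ) + 2 = n + 4 at this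
          omega
        · exact fresh v _ (by show (n : ℤ) + 2 ≤ n + 4; omega) h)
      (by simp)
    refine ⟨_, by push_cast; exact p3, ?_, ?_, ?_, ?_⟩
    · rw [b5]; exact h5
    · rw [b1]; push_cast; rfl
    · rintro (_ | _ | _ | v) hv'
      · exact absurd b2.symm (hv' _)
      · exact absurd b0.symm (hv' _)
      · exact absurd b1.symm (hv' _)
      · exact (hv v fun e => hv' (lab ht 5)
          ((congrArg (fun v => some (some (some v))) e).trans b5.symm)).2
    · intro i i5 i1
      by_cases i2 : i = lab ht 2
      · subst i2
        exact joinNew_empty_isolated _ _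
      · refine joinNew_isolated i2 (by simp) ?_
        by_cases i0 : i = lab ht 0
        · subst i0
          exact joinNew_empty_isolated _ _
        · exact joinNew_isolated i0 (by simp) (joinNew_isolated i1 (by simpa) (hi i i5 i0 i2))

/-! ### The structure of a gluing, and gluing strips with paths -/

/-- The vertices without a label. -/
abbrev Inner (H : BoundariedGraph t) : Type := {w : H.V // ∀ i, w ≠ H.boundary i}

open Classical in
/-- The vertex of the gluing that comes from a vertex of the right graph, as a vertex of the left
graph or an unlabeled vertex of the right one. -/
noncomputable def rightVertex (G H : BoundariedGraph t) (w : H.V) : G.V ⊕ H.Inner :=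
  if h : ∃ i, w = H.boundary i then .inl (G.boundary h.choose) else .inr ⟨w, not_exists.1 h⟩

theorem rightVertex_boundary (G H : BoundariedGraph t) (i : Fin t) :
    rightVertex G H (H.boundary i) = .inl (G.boundary i) := by
  have h : ∃ j, H.boundary i = H.boundary j := ⟨i, rfl⟩
  rw [rightVertex, dif_pos h, ← H.boundary.injective h.choose_spec]

theorem rightVertex_inner (G H : BoundariedGraph t) (w : H.Inner) :
    rightVertex G H w = .inr w := dif_neg (not_exists.2 w.2)

theorem rightVertex_eq_inl {G H : BoundariedGraph t} {w : H.V} {u : G.V}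
    (h : rightVertex G H w = .inl u) : ∃ i, w = H.boundary i ∧ u = G.boundary i := by
  by_cases hw : ∃ i, w = H.boundary i
  · obtain ⟨i, rfl⟩ := hw
    rw [rightVertex_boundary] at h
    exact ⟨i, rfl, (Sum.inl.inj h).symm⟩
  · rw [rightVertex, dif_neg hw] at h
    cases h

theorem rightVertex_eq_inr {G H : BoundariedGraph t} {w : H.V} {x : H.Inner}
    (h : rightVertex G H w = .inr x) : w = x := by
  by_cases hw : ∃ i, w = H.boundary i
  · obtain ⟨i, rfl⟩ := hw
    rw [rightVertex_boundary] at h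
    cases h
  · rw [rightVertex, dif_neg hw] at h
    rw [← Sum.inr.inj h]

theorem rightVertex_injective (G H : BoundariedGraph t) :
    Function.Injective (rightVertex G H) := by
  intro w w' h
  rcases h' : rightVertex G H w' with u | x
  · obtain ⟨i, rfl, hi⟩ := rightVertex_eq_inl (h.trans h')
    obtain ⟨j, rfl, hj⟩ := rightVertex_eq_inl h'
    rw [G.boundary.injective (hi.symm.trans hj)]
  · rw [rightVertex_eq_inr (h.trans h'), rightVertex_eq_inr h']

/-- The vertices of the gluing are the vertices of the left graph and the unlabeled vertices of the
right graph. -/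
noncomputable def glueEquiv (G H : BoundariedGraph t) : GlueV G H ≃ G.V ⊕ H.Inner where
  toFun := Quot.lift (Sum.elim .inl (rightVertex G H)) (by
    rintro _ _ ⟨i⟩
    exact (rightVertex_boundary G H i).symm)
  invFun := Sum.elim (glueLeft G H) fun w => glueRight G H w
  left_inv := by
    rintro ⟨v | w⟩
    · rfl
    · change Sum.elim (glueLeft G H) (fun w : H.Inner => glueRight G H w.1) (rightVertex G H w) =
        glueRight G H w
      rcases h : rightVertex G H w with u | x
      · obtain ⟨i, rfl, rfl⟩ := rightVertex_eq_inl h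
        exact Quot.sound (.label i)
      · rw [rightVertex_eq_inr h]
        rfl
  right_inv := by
    rintro (v | w)
    · rfl
    · exact rightVertex_inner G H w

theorem glueRight_injective (G H : BoundariedGraph t) : Function.Injective (glueRight G H) :=
  fun _ _ h => rightVertex_injective G H (congrArg (glueEquiv G H) h)

theorem glue_adj (G H : BoundariedGraph t) (x y : GlueV G H) : (G.glue H).graph.Adj x y ↔
    (∃ u v, G.graph.Adj u v ∧ x = glueLeft G H u ∧ y = glueLeft G H v) ∨
    (∃ u v, H.graph.Adj u v ∧ x = glueRight G H u ∧ y = glueRight G H v) := by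
  refine (SimpleGraph.fromRel_adj _ _ _).trans ?_
  constructor
  · rintro ⟨-, h | ⟨u, v, h, hy, hx⟩ | ⟨u, v, h, hy, hx⟩⟩
    · exact h
    · exact .inl ⟨v, u, h.symm, hx, hy⟩
    · exact .inr ⟨v, u, h.symm, hx, hy⟩
  · intro h
    refine ⟨?_, .inl h⟩
    rcases h with ⟨u, v, h, rfl, rfl⟩ | ⟨u, v, h, rfl, rfl⟩
    · exact (glueLeft_injective G H).ne h.ne
    · exact (glueRight_injective G H).ne h.ne

/-- The left graph as a subgraph of the gluing. -/
def glueLeftHom (G H : BoundariedGraph t) : G.graph →g (G.glue H).graph where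
  toFun := glueLeft G H
  map_rel' h := (glue_adj ..).2 (.inl ⟨_, _, h, rfl, rfl⟩)

/-- The right graph as a subgraph of the gluing. -/
def glueRightHom (G H : BoundariedGraph t) : H.graph →g (G.glue H).graph where
  toFun := glueRight G H
  map_rel' h := (glue_adj ..).2 (.inr ⟨_, _, h, rfl, rfl⟩)

theorem glueRight_boundary (G H : BoundariedGraph t) (i : Fin t) :
    glueRight G H (H.boundary i) = glueLeft G H (G.boundary i) :=
  (Quot.sound (GlueRel.label i)).symm

theorem not_isLeveledPlanar_glue (ht : 6 ≤ t) {n N : ℕ} (h : N < n) {G H : BoundariedGraph t}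
    (hG : IsStrip ht n G) (hH : IsPath ht N H) : ¬ IsLeveledPlanar (G.glue H).graph := by
  rintro ⟨D⟩
  obtain ⟨ε, hε, -, h1⟩ := hG.1.2 _ _ D (glueLeftHom G H) (glueLeft_injective G H)
  have h2 := hH.1 _ _ D (glueRightHom G H)
  change |D.level (glueRight G H _) - D.level (glueRight G H _)| ≤ _ at h2
  rw [glueRight_boundary, glueRight_boundary, abs_le] at h2
  change _ ≤ ε * (D.level (glueLeft G H _) - D.level (glueLeft G H _)) at h1
  rcases hε with rfl | rfl <;> omega

/-- The two placements agree at the labels `6` and `2`, the only boundary vertices at which the path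
has edges, and elsewhere the columns keep them apart. Their union has only host edges, which do not
cross. -/
theorem isLeveledPlanar_glue (ht : 6 ≤ t) {n : ℕ} {G H : BoundariedGraph t}
    (hG : IsStrip ht n G) (hH : IsPath ht (n + 2) H) : IsLeveledPlanar (G.glue H).graph := by
  obtain ⟨-, φ, hφ, φ5, -, φ1, hv⟩ := hG
  obtain ⟨-, χ, hχ, χ5, χ1, hw, hi⟩ := hH
  push_cast at hχ χ1
  let ψ : GlueV G H → ℤ × ℤ := fun x => Sum.elim φ (fun w : H.Inner => χ w.1) (glueEquiv G H x)
  have ψl : ∀ v, ψ (glueLeft G H v) = φ v := fun v => rfl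
  -- On boundary vertices `ψ` follows the strip; it may differ from `χ` only at vertices isolated in
  -- `H`, which carry no edge condition.
  have ψr : ∀ w w', H.graph.Adj w w' → ψ (glueRight G H w) = χ w := by
    intro w w' h
    by_cases hw : ∃ i, w = H.boundary i
    · obtain ⟨i, rfl⟩ := hw
      rw [glueRight_boundary, ψl]
      by_cases i5 : i = lab ht 5
      · rw [i5, φ5, χ5]
      by_cases i1 : i = lab ht 1
      · rw [i1, φ1, χ1]
      exact absurd h (hi i i5 i1 w')
    · change Sum.elim φ (fun w : H.Inner => χ w.1) (rightVertex G H w) = _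
      rw [rightVertex, dif_neg hw]
      rfl
  have ψinj : Function.Injective ψ := by
    have : Function.Injective (Sum.elim φ fun w : H.Inner => χ w.1) := by
      refine hφ.injective.sumElim (hχ.injective.comp Subtype.val_injective) ?_
      intro v w e
      have h1 := (hv v).2
      rw [e, hw w w.2] at h1
      omega
    exact this.comp (glueEquiv G H).injective
  -- The strip has only the point `(n + 2, 0)` above level `n + 1`, which gives the condition of
  -- `HostEdge` at the top.
  have strip : ∀ u v, StripEdge (φ u) (φ v) → HostEdge (n + 2) (φ u) (φ v) := by
    intro u v h
    refine ⟨h.1, h.2.1, ?_, h.2.2.1, ?_, fun _ _ => .inl h⟩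
    · rcases (hv v).1 with h | h
      · rw [h]
      · omega
    · intro e
      rcases (hv v).1 with h | h
      · rw [h]
      · omega
  have host : ∀ x y, (G.glue H).graph.Adj x y →
      HostEdge (n + 2) (ψ x) (ψ y) ∨ HostEdge (n + 2) (ψ y) (ψ x) := by
    intro x y h
    rcases (glue_adj ..).1 h with ⟨u, v, a, rfl, rfl⟩ | ⟨u, v, a, rfl, rfl⟩
    · exact (hφ.adj u v a).imp (strip _ _) (strip _ _)
    · rw [ψr _ _ a, ψr _ _ a.symm]
      exact hχ.adj u v a
  refine isLeveledPlanar_of_placement (fun x => (ψ x).1) (fun x => (ψ x).2) ?_ ?_ ?_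
  · intro x y h1 h2
    exact ψinj (Prod.ext h1 h2)
  · intro x y h
    rcases host x y h with h | h <;> have := h.2.1
    · rw [this]; norm_num
    · rw [this]; norm_num
  · intro u v u' v' h h' l l' e lt
    have up : ∀ u v, (G.glue H).graph.Adj u v → (ψ v).1 = (ψ u).1 + 1 →
        HostEdge (n + 2) (ψ u) (ψ v) := by
      intro u v h l
      refine (host u v h).resolve_right fun h => ?_
      have := h.2.1
      omega
    exact (up u v h l).not_crossing (up u' v' h' l') e lt

/-- Only the labels `6` and `2` have edges, and they are placed `n + 2 ≥ 2` levels apart. Hence no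
edge of the path can merge with an edge of the other graph, which keeps the edge sets disjoint in
the logical argument. -/
theorem IsPath.not_adj_boundary {ht : 6 ≤ t} {n : ℕ} {H : BoundariedGraph t}
    (h : IsPath ht (n + 2) H) (i j : Fin t) : ¬ H.graph.Adj (H.boundary i) (H.boundary j) := by
  obtain ⟨-, χ, hχ, χ5, χ1, hw, hi⟩ := h
  push_cast at hχ χ1
  intro hij
  have key : ∀ k l, H.graph.Adj (H.boundary k) (H.boundary l) → k = lab ht 5 ∨ k = lab ht 1 := by
    intro k l hkl
    by_contra! hk
    exact hi k hk.1 hk.2 _ hkl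
  rcases key _ _ hij with rfl | rfl <;> rcases key _ _ hij.symm with rfl | rfl
  · exact hij.ne rfl
  · rcases hχ.adj _ _ hij with h | h <;> rw [χ5, χ1] at h <;> have := h.2.1 <;> simp at this <;>
      omega
  · rcases hχ.adj _ _ hij with h | h <;> rw [χ5, χ1] at h <;> have := h.2.1 <;> simp at this <;>
      omega
  · exact hij.ne rfl

end BoundariedGraph

/-! ### Composition of types for counting monadic second-order logic -/

/-- Truth of a formula in an incidence structure: a type of elements, the predicate of being a
vertex and the incidence relation. -/
def CMSO.Sat {U : Type} (P : U → Prop) (I : U → U → Prop) : {m n : ℕ} → CMSO m n →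
    (Fin m → U) → (Fin n → Set U) → Prop
  | _, _, .isVertex x, a, _ => P (a x)
  | _, _, .inc x y, a, _ => I (a x) (a y)
  | _, _, .eq x y, a, _ => a x = a y
  | _, _, .mem x X, a, S => a x ∈ S X
  | _, _, .card q r _ X, _, S => (S X).ncard ≡ r [MOD q]
  | _, _, .not φ, a, S => ¬ φ.Sat P I a S
  | _, _, .and φ ψ, a, S => φ.Sat P I a S ∧ ψ.Sat P I a S
  | _, _, .exElem φ, a, S => ∃ z : U, φ.Sat P I (Fin.cons z a) S
  | _, _, .exSet φ, a, S => ∃ Z : Set U, φ.Sat P I a (Fin.cons Z S)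

theorem comp_cons_fin {α β : Type*} {n : ℕ} (f : α → β) (x : α) (a : Fin n → α) :
    (fun i => f (Fin.cons (α := fun _ => α) x a i)) = Fin.cons (f x) fun i => f (a i) := by
  funext i
  cases i using Fin.cases <;> rfl

/-- An isomorphism of incidence structures preserves truth. -/
theorem CMSO.holds_iff_sat {V U : Type} (G : SimpleGraph V) (e : U ≃ V ⊕ G.edgeSet) {P : U → Prop}
    {I : U → U → Prop} (hP : ∀ u, P u ↔ ∃ v : V, e u = Sum.inl v)
    (hI : ∀ u u', I u u' ↔ ∃ (v : V) (d : G.edgeSet),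
      e u = Sum.inl v ∧ e u' = Sum.inr d ∧ v ∈ (d : Sym2 V))
    {m n : ℕ} (φ : CMSO m n) (a : Fin m → U) (S : Fin n → Set U) :
    φ.Holds G (fun i => e (a i)) (fun j => e '' S j) ↔ φ.Sat P I a S := by
  induction φ with
  | isVertex x => exact (hP _).symm
  | inc x y => exact (hI _ _).symm
  | eq x y => exact e.apply_eq_iff_eq
  | mem x X => exact e.injective.mem_set_image
  | card q r hq X =>
    simp only [CMSO.Holds, CMSO.Sat]
    rw [Set.ncard_image_of_injective _ e.injective]
  | not φ ih => exact not_congr (ih a S)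
  | and φ ψ ih ih' => exact and_congr (ih a S) (ih' a S)
  | exElem φ ih =>
    simp only [CMSO.Holds, CMSO.Sat]
    refine e.surjective.exists.trans (exists_congr fun z => ?_)
    rw [← ih, comp_cons_fin]
  | exSet φ ih =>
    simp only [CMSO.Holds, CMSO.Sat]
    refine (Set.image_surjective.2 e.surjective).exists.trans (exists_congr fun Z => ?_)
    rw [← ih, comp_cons_fin]

/-- An incidence structure with marked elements. -/
structure MarkedStructure (t : ℕ) where
  U : Type
  finite : Finite U
  isVertex : U → Prop
  inc : U → U → Prop
  mark : Fin t → U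

/-- A structure whose elements can in addition be incident to the marked elements of another one. -/
structure ContextStructure (t : ℕ) where
  U : Type
  finite : Finite U
  isVertex : U → Prop
  inc : U → U → Prop
  incMark : Fin t → U → Prop

namespace MarkedStructure

variable {t : ℕ}

/-- The vertices of the union of a marked structure and a context. -/
def unionVertex (M : MarkedStructure t) (R : ContextStructure t) : M.U ⊕ R.U → Prop :=
  Sum.elim M.isVertex R.isVertex

/-- The incidence relation of the union of a marked structure and a context. -/
def unionInc (M : MarkedStructure t) (R : ContextStructure t) : M.U ⊕ R.U → M.U ⊕ R.U → Prop
  | .inl u, .inl v => M.inc u v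
  | .inl u, .inr r => ∃ i, u = M.mark i ∧ R.incMark i r
  | .inr _, .inl _ => False
  | .inr r, .inr s => R.inc r s

/-- An assignment of values to the element variables, restricted to the left part. -/
def leftElems {A B : Type} {m : ℕ} (a : Fin m → A ⊕ B) (i : Fin m) : Option A := (a i).getLeft?

/-- An assignment of values to the set variables, restricted to the left part. -/
def leftSets {A B : Type} {n : ℕ} (S : Fin n → Set (A ⊕ B)) (j : Fin n) : Set A := Sum.inl ⁻¹' S j

theorem leftElems_cons {A B : Type} {m : ℕ} (z : A ⊕ B) (a : Fin m → A ⊕ B) :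
    leftElems (Fin.cons z a) = Fin.cons z.getLeft? (leftElems a) := comp_cons_fin _ z a

theorem leftSets_cons {A B : Type} {n : ℕ} (Z : Set (A ⊕ B)) (S : Fin n → Set (A ⊕ B)) :
    leftSets (Fin.cons Z S) = Fin.cons (Sum.inl ⁻¹' Z) (leftSets S) := comp_cons_fin _ Z S

theorem ncard_sum {A B : Type} [Finite A] [Finite B] (Z : Set (A ⊕ B)) :
    Z.ncard = (Sum.inl ⁻¹' Z : Set A).ncard + (Sum.inr ⁻¹' Z : Set B).ncard := by
  rw [← Set.ncard_image_of_injective _ (Sum.inl_injective (α := A) (β := B)),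
    ← Set.ncard_image_of_injective _ (Sum.inr_injective (α := A) (β := B)), ← Set.ncard_union_eq]
  · rw [Set.image_preimage_inl_union_image_preimage_inr]
  · rw [Set.disjoint_left]
    rintro _ ⟨x, -, rfl⟩ ⟨y, -, h⟩
    cases h

/-- The truth of a formula in the union of a marked structure and a context depends on the marked
structure only through a type, of which there are finitely many. -/
theorem exists_finite_type (t : ℕ) {m n : ℕ} (φ : CMSO m n) : ∃ (F : Type) (_ : Finite F)
    (τ : (M : MarkedStructure t) → (Fin m → Option M.U) → (Fin n → Set M.U) → F),
    ∀ (M M' : MarkedStructure t) (R : ContextStructure t) (a : Fin m → M.U ⊕ R.U)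
      (a' : Fin m → M'.U ⊕ R.U) (S : Fin n → Set (M.U ⊕ R.U)) (S' : Fin n → Set (M'.U ⊕ R.U)),
      (∀ i, (a i).getRight? = (a' i).getRight?) →
      (∀ j, (Sum.inr ⁻¹' S j : Set R.U) = Sum.inr ⁻¹' S' j) →
      τ M (leftElems a) (leftSets S) = τ M' (leftElems a') (leftSets S') →
      φ.Sat (M.unionVertex R) (M.unionInc R) a S →
      φ.Sat (M'.unionVertex R) (M'.unionInc R) a' S' := by
  -- Elements on the right are the same in both unions, and the left side sees such a value as
  -- `none`. Atomic formulas need finitely much information about the left side; quantifiers pass to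
  -- sets of types.
  induction φ with
  | isVertex x =>
    refine ⟨Prop, inferInstance, fun M a _ => ∃ u, a x = some u ∧ M.isVertex u, ?_⟩
    intro M M' R a a' S S' ha _ hτ h
    have hx := ha x
    simp only [CMSO.Sat, leftElems] at hτ h ⊢
    rcases e : a x with u | r <;> rcases e' : a' x with u' | r' <;>
      simp_all [unionVertex]
  | inc x y =>
    -- Left elements are incident to right ones only through marks, so it is enough to know which
    -- marks the value of `x` equals.
    refine ⟨Prop × (Fin t → Prop), inferInstance, fun M a _ =>
      (∃ u v, a x = some u ∧ a y = some v ∧ M.inc u v, fun i => a x = some (M.mark i)), ?_⟩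
    intro M M' R a a' S S' ha _ hτ h
    have hx := ha x
    have hy := ha y
    simp only [CMSO.Sat, leftElems, Prod.mk.injEq, funext_iff] at hτ h ⊢
    obtain ⟨h1, h2⟩ := hτ
    rcases e : a x with u | r <;> rcases e' : a' x with u' | r' <;>
    rcases d : a y with v | s <;> rcases d' : a' y with v' | s' <;>
      simp_all [unionInc]
  | eq x y =>
    refine ⟨Prop, inferInstance, fun M a _ => ∃ u, a x = some u ∧ a y = some u, ?_⟩
    intro M M' R a a' S S' ha _ hτ h
    have hx := ha x
    have hy := ha y
    simp only [CMSO.Sat, leftElems] at hτ h ⊢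
    rcases e : a x with u | r <;> rcases e' : a' x with u' | r' <;>
    rcases d : a y with v | s <;> rcases d' : a' y with v' | s' <;>
      simp_all
  | mem x X =>
    refine ⟨Prop, inferInstance, fun M a S => ∃ u, a x = some u ∧ u ∈ S X, ?_⟩
    intro M M' R a a' S S' ha hS hτ h
    have hx := ha x
    have hX := hS X
    simp only [CMSO.Sat, leftElems, leftSets] at hτ h ⊢
    rcases e : a x with u | r <;> rcases e' : a' x with u' | r' <;> rw [e] at h hτ hx <;>
      rw [e'] at hx hτ
    · simpa [h] using hτ
    · simp at hx
    · simp at hx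
    · obtain rfl : r = r' := by simpa using hx
      exact (Set.ext_iff.1 hX r).1 h
  | card q r hq X =>
    refine ⟨Fin q, inferInstance, fun M _ S => ⟨(S X).ncard % q, Nat.mod_lt _ hq⟩, ?_⟩
    intro M M' R a a' S S' _ hS hτ h
    have := M.finite
    have := M'.finite
    have := R.finite
    simp only [CMSO.Sat, Fin.mk.injEq] at hτ h ⊢
    refine Nat.ModEq.trans ?_ h
    rw [ncard_sum (S X), ncard_sum (S' X), hS X]
    exact Nat.ModEq.add_right _ hτ.symm
  | not φ ih =>
    obtain ⟨F, hF, τ, ih⟩ := ih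
    -- The implication for `φ` is used with `M` and `M'` exchanged.
    exact ⟨F, hF, τ, fun M M' R a a' S S' ha hS hτ h h' =>
      h (ih M' M R a' a S' S (fun i => (ha i).symm) (fun j => (hS j).symm) hτ.symm h')⟩
  | and φ ψ ih ih' =>
    obtain ⟨F, hF, τ, ih⟩ := ih
    obtain ⟨F', hF', τ', ih'⟩ := ih'
    refine ⟨F × F', inferInstance, fun M a S => (τ M a S, τ' M a S), ?_⟩
    intro M M' R a a' S S' ha hS hτ h
    obtain ⟨h1, h2⟩ := Prod.mk.inj hτ
    exact ⟨ih M M' R a a' S S' ha hS h1 h.1, ih' M M' R a a' S S' ha hS h2 h.2⟩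
  | exElem φ ih =>
    obtain ⟨F, hF, τ, ih⟩ := ih
    -- The first component lists the types reached by a witness on the left; the second is the type
    -- after a witness on the right, which is `none` for the left side.
    refine ⟨Set F × F, inferInstance, fun M a S =>
      (Set.range fun u => τ M (Fin.cons (some u) a) S, τ M (Fin.cons none a) S), ?_⟩
    rintro M M' R a a' S S' ha hS hτ ⟨z, h⟩
    obtain ⟨h1, h2⟩ := Prod.mk.inj hτ
    rcases z with u | r
    · obtain ⟨u', hu'⟩ : τ M (Fin.cons (some u) (leftElems a)) (leftSets S) ∈
          Set.range fun u => τ M' (Fin.cons (some u) (leftElems a')) (leftSets S') :=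
        h1 ▸ ⟨u, rfl⟩
      refine ⟨.inl u', ih M M' R (Fin.cons (.inl u) a) (Fin.cons (.inl u') a') S S' ?_ hS ?_ h⟩
      · intro i
        cases i using Fin.cases
        · rfl
        · exact ha _
      · rw [leftElems_cons, leftElems_cons]
        exact hu'.symm
    · refine ⟨.inr r, ih M M' R (Fin.cons (.inr r) a) (Fin.cons (.inr r) a') S S' ?_ hS ?_ h⟩
      · intro i
        cases i using Fin.cases
        · rfl
        · exact ha _
      · rw [leftElems_cons, leftElems_cons]
        exact h2
  | exSet φ ih =>
    obtain ⟨F, hF, τ, ih⟩ := ih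
    refine ⟨Set F, inferInstance, fun M a S => Set.range fun Z => τ M a (Fin.cons Z S), ?_⟩
    rintro M M' R a a' S S' ha hS hτ ⟨Z, h⟩
    obtain ⟨Y, hY⟩ : τ M (leftElems a) (Fin.cons (Sum.inl ⁻¹' Z) (leftSets S)) ∈
        Set.range fun Z => τ M' (leftElems a') (Fin.cons Z (leftSets S')) :=
      Eq.subset (show Set.range _ = Set.range _ from hτ) ⟨_, rfl⟩
    -- A set witness is transferred by halves: its left part is replaced by a set `Y` of the same
    -- type, its right part is kept.
    have hl : (Sum.inl ⁻¹' (Sum.inl '' Y ∪ Sum.inr '' (Sum.inr ⁻¹' Z : Set R.U)) : Set M'.U) = Y := by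
      ext; simp
    have hr : (Sum.inr ⁻¹' Z : Set R.U) =
        Sum.inr ⁻¹' (Sum.inl '' Y ∪ Sum.inr '' (Sum.inr ⁻¹' Z : Set R.U)) := by
      ext; simp
    refine ⟨Sum.inl '' Y ∪ Sum.inr '' (Sum.inr ⁻¹' Z), ih M M' R a a' (Fin.cons Z S) _ ha ?_ ?_ h⟩
    · intro j
      cases j using Fin.cases
      · exact hr
      · exact hS _
    · rw [leftSets_cons, leftSets_cons, hl]
      exact hY.symm

end MarkedStructure

/-! ### The incidence structure of a gluing as a union -/

namespace BoundariedGraph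

variable {t : ℕ}

/-- The incidence structure of a boundaried graph. -/
def markedStructure (G : BoundariedGraph t) : MarkedStructure t where
  U := G.V ⊕ G.graph.edgeSet
  finite := by
    have := G.finite
    infer_instance
  isVertex x := ∃ v, x = .inl v
  inc x y := ∃ (v : G.V) (d : G.graph.edgeSet), x = .inl v ∧ y = .inr d ∧ v ∈ (d : Sym2 G.V)
  mark i := .inl (G.boundary i)

/-- The incidence structure of a boundaried graph without its boundary vertices. -/
def contextStructure (H : BoundariedGraph t) : ContextStructure t where
  U := H.Inner ⊕ H.graph.edgeSet
  finite := by
    have := H.finite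
    infer_instance
  isVertex x := ∃ v, x = .inl v
  inc x y := ∃ (v : H.Inner) (d : H.graph.edgeSet), x = .inl v ∧ y = .inr d ∧ v.1 ∈ (d : Sym2 H.V)
  incMark i y := ∃ d : H.graph.edgeSet, y = .inr d ∧ H.boundary i ∈ (d : Sym2 H.V)

/-- The elements of the gluing that come from the elements of its two sides. -/
def glueElem (G H : BoundariedGraph t) :
    G.markedStructure.U ⊕ H.contextStructure.U → (G.glue H).V ⊕ (G.glue H).graph.edgeSet
  | .inl (.inl v) => .inl (glueLeft G H v)
  | .inl (.inr d) => .inr ((glueLeftHom G H).mapEdgeSet d)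
  | .inr (.inl w) => .inl (glueRight G H w.1)
  | .inr (.inr d) => .inr ((glueRightHom G H).mapEdgeSet d)

theorem glueLeft_eq_glueRight {G H : BoundariedGraph t} {v : G.V} {w : H.V}
    (h : glueLeft G H v = glueRight G H w) : ∃ i, w = H.boundary i ∧ v = G.boundary i :=
  rightVertex_eq_inl (congrArg (glueEquiv G H) h).symm

theorem glueLeft_ne_glueRight_inner {G H : BoundariedGraph t} (v : G.V) (w : H.Inner) :
    glueLeft G H v ≠ glueRight G H w := by
  intro h
  obtain ⟨i, hi, -⟩ := glueLeft_eq_glueRight h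
  exact w.2 i hi

/-- Boundary vertices are counted on the left only. An edge from both sides would have both ends in
the boundary, which the hypothesis on `H` excludes, so the merging of parallel edges never takes
place. -/
theorem glueElem_bijective (G H : BoundariedGraph t)
    (hH : ∀ i j, ¬ H.graph.Adj (H.boundary i) (H.boundary j)) :
    Function.Bijective (glueElem G H) := by
  have hlr : ∀ (d : G.graph.edgeSet) (d' : H.graph.edgeSet),
      (glueLeftHom G H).mapEdgeSet d ≠ (glueRightHom G H).mapEdgeSet d' := by
    rintro ⟨d, hd⟩ ⟨d', hd'⟩ h
    have h := congrArg Subtype.val h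
    induction d with | _ u v
    induction d' with | _ w x
    change s(glueLeft G H u, glueLeft G H v) = s(glueRight G H w, glueRight G H x) at h
    rcases Sym2.eq_iff.1 h with ⟨h1, h2⟩ | ⟨h1, h2⟩ <;>
    · obtain ⟨i, rfl, -⟩ := glueLeft_eq_glueRight h1
      obtain ⟨j, rfl, -⟩ := glueLeft_eq_glueRight h2
      first | exact hH i j hd' | exact hH j i hd'
  have hl := SimpleGraph.Hom.mapEdgeSet.injective (glueLeftHom G H) (glueLeft_injective G H)
  have hr := SimpleGraph.Hom.mapEdgeSet.injective (glueRightHom G H) (glueRight_injective G H)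
  constructor
  · rintro ((v | d) | (w | d)) ((v' | d') | (w' | d')) h <;>
      first
      | cases h
      | skip
    · rw [glueLeft_injective G H (Sum.inl.inj h)]
    · exact absurd (Sum.inl.inj h) (glueLeft_ne_glueRight_inner _ _)
    · rw [hl (Sum.inr.inj h)]
    · exact absurd (Sum.inr.inj h) (hlr _ _)
    · exact absurd (Sum.inl.inj h).symm (glueLeft_ne_glueRight_inner _ _)
    · rw [Subtype.ext (glueRight_injective G H (Sum.inl.inj h))]
    · exact absurd (Sum.inr.inj h).symm (hlr _ _)
    · rw [hr (Sum.inr.inj h)]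
  · rintro (x | ⟨d, hd⟩)
    · obtain ⟨y, rfl⟩ := (glueEquiv G H).symm.surjective x
      rcases y with v | w
      · exact ⟨.inl (.inl v), rfl⟩
      · exact ⟨.inr (.inl w), rfl⟩
    · induction d with | _ x y
      rcases (glue_adj ..).1 hd with ⟨u, v, h, rfl, rfl⟩ | ⟨u, v, h, rfl, rfl⟩
      · exact ⟨.inl (.inr ⟨s(u, v), h⟩), rfl⟩
      · exact ⟨.inr (.inr ⟨s(u, v), h⟩), rfl⟩

theorem glueElem_isVertex (G H : BoundariedGraph t)
    (x : G.markedStructure.U ⊕ H.contextStructure.U) :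
    G.markedStructure.unionVertex H.contextStructure x ↔ ∃ v, glueElem G H x = .inl v := by
  rcases x with (v | d) | (w | d)
  · exact ⟨fun _ => ⟨_, rfl⟩, fun _ => ⟨v, rfl⟩⟩
  · exact ⟨(by rintro ⟨_, ⟨⟩⟩), (by rintro ⟨_, ⟨⟩⟩)⟩
  · exact ⟨fun _ => ⟨_, rfl⟩, fun _ => ⟨w, rfl⟩⟩
  · exact ⟨(by rintro ⟨_, ⟨⟩⟩), (by rintro ⟨_, ⟨⟩⟩)⟩

theorem glueElem_inc (G H : BoundariedGraph t)
    (x y : G.markedStructure.U ⊕ H.contextStructure.U) :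
    G.markedStructure.unionInc H.contextStructure x y ↔
      ∃ (v : (G.glue H).V) (d : (G.glue H).graph.edgeSet),
        glueElem G H x = .inl v ∧ glueElem G H y = .inr d ∧ v ∈ (d : Sym2 (G.glue H).V) := by
  have red : ∀ {A B : Type} {p : A → B → Prop} (a : A) (b : B),
      (∃ v d, (Sum.inl a : A ⊕ B) = .inl v ∧ (Sum.inr b : A ⊕ B) = .inr d ∧ p v d) ↔ p a b := by
    intro A B p a b
    constructor
    · rintro ⟨v, d, h1, h2, h⟩
      cases h1
      cases h2
      exact h
    · exact fun h => ⟨a, b, rfl, rfl, h⟩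
  rcases x with (v | d) | (w | d)
  · rcases y with (v' | d') | (w' | d')
    · exact ⟨(by rintro ⟨_, _, _, ⟨⟩, _⟩), (by rintro ⟨_, _, _, ⟨⟩, _⟩)⟩
    · refine (red v d').trans (Iff.trans ?_ (red _ _).symm)
      change _ ↔ glueLeft G H v ∈ Sym2.map (glueLeft G H) d'
      rw [Sym2.mem_map]
      exact ⟨fun h => ⟨v, h, rfl⟩, fun ⟨u, h, e⟩ => glueLeft_injective G H e ▸ h⟩
    · exact ⟨(by rintro ⟨_, _, _, ⟨⟩, _⟩), (by rintro ⟨_, _, _, ⟨⟩, _⟩)⟩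
    · refine Iff.trans ?_ (red _ _).symm
      change _ ↔ glueLeft G H v ∈ Sym2.map (glueRight G H) d'
      rw [Sym2.mem_map]
      constructor
      · rintro ⟨i, hv, d, hd, hi⟩
        cases hv
        cases hd
        exact ⟨_, hi, glueRight_boundary G H i⟩
      · rintro ⟨w, hw, e⟩
        obtain ⟨i, rfl, rfl⟩ := glueLeft_eq_glueRight e.symm
        exact ⟨i, rfl, d', rfl, hw⟩
  · rcases y with y | y
    · exact ⟨(by rintro ⟨_, _, ⟨⟩, _⟩), (by rintro ⟨_, _, ⟨⟩, _⟩)⟩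
    · exact ⟨(by rintro ⟨_, ⟨⟩, _⟩), (by rintro ⟨_, _, ⟨⟩, _⟩)⟩
  · rcases y with (v' | d') | (w' | d')
    · exact ⟨(by rintro ⟨⟩), (by rintro ⟨_, _, _, ⟨⟩, _⟩)⟩
    · refine ⟨(by rintro ⟨⟩), fun h => ?_⟩
      have h := (red _ _).1 h
      change glueRight G H w ∈ Sym2.map (glueLeft G H) d' at h
      obtain ⟨u, -, e⟩ := Sym2.mem_map.1 h
      exact glueLeft_ne_glueRight_inner u w e
    · exact ⟨(by rintro ⟨_, _, _, ⟨⟩, _⟩), (by rintro ⟨_, _, _, ⟨⟩, _⟩)⟩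
    · refine (red w d').trans (Iff.trans ?_ (red _ _).symm)
      change _ ↔ glueRight G H w ∈ Sym2.map (glueRight G H) d'
      rw [Sym2.mem_map]
      exact ⟨fun h => ⟨w, h, rfl⟩, fun ⟨u, h, e⟩ => glueRight_injective G H e ▸ h⟩
  · rcases y with y | y
    · exact ⟨(by rintro ⟨⟩), (by rintro ⟨_, _, ⟨⟩, _⟩)⟩
    · exact ⟨(by rintro ⟨_, _, ⟨⟩, _⟩), (by rintro ⟨_, _, ⟨⟩, _⟩)⟩

/-- For every formula, the boundaried graphs fall into finitely many classes such that the truth of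
the formula in a gluing depends only on the class of the left graph. -/
theorem exists_finite_class (t : ℕ) (φ : CMSO 0 0) : ∃ (F : Type) (_ : Finite F)
    (τ : BoundariedGraph t → F), ∀ G G' H : BoundariedGraph t,
      (∀ i j, ¬ H.graph.Adj (H.boundary i) (H.boundary j)) → τ G = τ G' →
      φ.Models (G.glue H).graph → φ.Models (G'.glue H).graph := by
  obtain ⟨F, hF, τ, h⟩ := MarkedStructure.exists_finite_type t φ
  refine ⟨F, hF, fun G => τ G.markedStructure Fin.elim0 Fin.elim0, fun G G' H hH hτ hG => ?_⟩
  have key : ∀ K : BoundariedGraph t, φ.Models (K.glue H).graph ↔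
      φ.Sat (K.markedStructure.unionVertex H.contextStructure)
        (K.markedStructure.unionInc H.contextStructure) Fin.elim0 Fin.elim0 := by
    intro K
    rw [← CMSO.holds_iff_sat (K.glue H).graph (Equiv.ofBijective _ (glueElem_bijective K H hH))
      (glueElem_isVertex K H) (glueElem_inc K H), CMSO.Models]
    congr! 1
  refine (key G').2 (h _ _ _ _ _ _ _ (fun i => i.elim0) (fun i => i.elim0) ?_ ((key G).1 hG))
  convert hτ using 1 <;> congr 1 <;> exact funext fun i => i.elim0

end BoundariedGraph

/-! ### The pigeonhole argument and the theorem -/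

/-- A property of graphs for which the truth in a gluing with an independent boundary on the right
depends only on one of finitely many classes of the left parse tree is not leveled planarity. -/
theorem not_finite_class_isLeveledPlanar {t : ℕ} (ht : 6 ≤ t) {F : Type} [Finite F]
    (c : ParseTree → F)
    (hc : ∀ T T' B : ParseTree,
      (∀ i j, ¬ (B.eval t).graph.Adj ((B.eval t).boundary i) ((B.eval t).boundary j)) →
      c T = c T' → IsLeveledPlanar ((T.glue B).eval t).graph →
      IsLeveledPlanar ((T'.glue B).eval t).graph) : False := by
  -- The factor `3` exceeds the slack of two: for `i < j`, the path of length `3 * i + 2` fits the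
  -- strip `3 * i` and is shorter than the distance `3 * j` forced by the other strip.
  have hA : ∀ n, ∃ T : ParseTree, BoundariedGraph.IsStrip ht (3 * n) (T.eval t) := by
    intro n
    obtain ⟨_, ⟨T, rfl⟩, h⟩ := BoundariedGraph.exists_isStrip ht (3 * n)
    exact ⟨T, h⟩
  choose A hA using hA
  obtain ⟨i, j, hij, e⟩ : ∃ i j, i < j ∧ c (A i) = c (A j) := by
    obtain ⟨i, j, hne, e⟩ := Finite.exists_ne_map_eq_of_infinite fun n => c (A n)
    rcases hne.lt_or_gt with h | h
    · exact ⟨i, j, h, e⟩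
    · exact ⟨j, i, h, e.symm⟩
  obtain ⟨_, ⟨B, rfl⟩, hB⟩ := BoundariedGraph.exists_isPath ht (3 * i)
  exact BoundariedGraph.not_isLeveledPlanar_glue ht (by omega) (hA j) hB
    (hc (A i) (A j) B hB.not_adj_boundary e (BoundariedGraph.isLeveledPlanar_glue ht (hA i) hB))

theorem mainTheorem8 (t : ℕ) (ht : 6 ≤ t) :
    ¬ IsFiniteState t (fun _ G => IsLeveledPlanar G) ∧
    ¬ ∃ φ : CMSO 0 0, ∀ T : ParseTree,
      φ.Models (T.eval t).graph ↔ IsLeveledPlanar (T.eval t).graph := by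
  constructor
  · rintro ⟨A, hA⟩
    have := A.finite
    -- The class is the whole set of reachable states, one of finitely many subsets; this covers
    -- nondeterministic automata, as the set reached at a gluing depends only on the sets reached at
    -- its two sides.
    refine not_finite_class_isLeveledPlanar ht A.reach fun T T' B _ e h => ?_
    refine (hA _).1 ?_
    have h := (hA _).2 h
    simpa only [TreeAutomaton.Accepts, TreeAutomaton.reach, e] using h
  · rintro ⟨φ, hφ⟩
    obtain ⟨F, hF, τ, h⟩ := BoundariedGraph.exists_finite_class t φ
    refine not_finite_class_isLeveledPlanar ht (fun T => τ (T.eval t)) fun T T' B hB e hT => ?_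
    rw [← hφ] at hT ⊢
    exact h _ _ _ hB e hT
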